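/- Let $d\ge 1$ and let $Y=(Y_t)_{t\ge0}$ be a Lévy process in $\mathbb R^d$ with generating triplet $(A,N,b)$, where $A$ is a symmetric non-negative definite matrix, $b\in\mathbb R^d$, and $N$ is a Borel measure on $\mathbb R^d$ with $N(\{0\})=0$ and $\int(1\wedge|z|^2)\,N(dz)<\infty$. That is, $\mathbb E e^{i\langle x,Y_t\rangle}=e^{-t\psi(x)}$ for all $t\ge 0$ and $x\in\mathbb R^d$, with $$\psi(x)=\langle x,Ax\rangle-i\langle x,b\rangle-\int_{\mathbb R^d}\big(e^{i\langle x,z\rangle}-1-i\langle x,z\rangle\mathbf 1_{|z|<1}\big)N(dz).$$ For $r>0$ put $$\psi^*(r)=\sup_{|z|\le r}\operatorname{Re}\psi(z),\qquad h(r)=r^{-2}\|A\|+\int_{\mathbb R^d}\Big(1\wedge\frac{|z|^2}{r^2}\Big)N(dz),$$ where $\|A\|$ is the operator norm. Assume that $\lim_{r\to0^+}h(r)=\infty$; then $h$ is a strictly decreasing bijection of $(0,\infty)$ onto itself, and $h^{-1}$ denotes its inverse. With the convention $1/\infty=0$, the following conditions are equivalent. * (C1) For every $t>0$ the law of $Y_t$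 has a density $p(t,\cdot)$ with respect to the Lebesgue measure and, for a suitable choice of versions of these densities, there are $T_1\in(0,\infty]$ and $c_1>0$ such that for all $0<t<T_1$, $$\sup_{x\in\mathbb R^d}p(t,x)\le c_1\,[h^{-1}(1/t)]^{-d}.$$ * (C2) There are $T_2\in(0,\infty]$ and $c_2>0$ such that for all $0<t<T_2$, $$\int_{\mathbb R^d}e^{-t\operatorname{Re}\psi(z)}\,dz\le c_2\,[h^{-1}(1/t)]^{-d}.$$ * (C3) There are $T_3\in(0,\infty]$, $c_3\in(0,1]$ and $\alpha_3\in(0,2]$ such that $c_3\,\psi^*(|x|)\le\operatorname{Re}\psi(x)$ for all $x \in\mathbb R^d$ with $|x|>1/T_3$, and $\psi^*(\lambda r)\ge c_3\lambda^{\alpha_3}\psi^*(r)$ for all $\lambda\ge1$ and $r>1/T_3$. * (C4) There are $T_4\in(0,\infty]$ and $c_4\in[1,\infty)$ such that for all $x\in\mathbb R^d$ with $|x|>1/T_4$, $$\psi^*(|x|)\le c_4\Big(\langle x,Ax\rangle+\int_{|\langle x,z\rangle|<1}|\langle x,z\rangle|^2\,N(dz)\Big).$$ Moreover, if one of these conditions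 holds with infinite time horizon ($T_i=\infty$ for some $i\in\{1,2,3,4\}$), then all four of them hold with infinite time horizon. -/

import Mathlib

open MeasureTheory ProbabilityTheory Filter Topology
open scoped ENNReal NNReal

noncomputable section

namespace LevySmallTime

/-- The space `ℝ^d` with its Euclidean norm and inner product. -/
abbrev E (d : ℕ) : Type := EuclideanSpace ℝ (Fin d)

/-- A Lévy process in `ℝ^d`: it has independent and stationary increments, starts at `0` almost
surely, is stochastically continuous, and has almost surely right-continuous paths with left
limits. -/
structure IsLevyProcess {d : ℕ} {Ω : Type*} [MeasurableSpace Ω] (Y : ℝ≥0 → Ω → E d)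
    (P : Measure Ω) : Prop where
  measurable : ∀ t, Measurable (Y t)
  indep_increments : HasIndepIncrements Y P
  starts_at_zero : ∀ᵐ ω ∂P, Y 0 ω = 0
  stationary_increments : ∀ s t, IdentDistrib (Y (s + t) - Y s) (Y t - Y 0) P P
  stochastically_continuous : ∀ t, TendstoInMeasure P Y (𝓝 t) (Y t)
  cadlag : ∀ᵐ ω ∂P, (∀ t, ContinuousWithinAt (fun s => Y s ω) (Set.Ici t) t) ∧
    ∀ t, 0 < t → ∃ y, Tendsto (fun s => Y s ω) (𝓝[<] t) (𝓝 y)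

/-- A triplet `(A, N, b)`: a symmetric non-negative definite matrix, a Lévy measure, a vector. -/
structure LevyTriplet (d : ℕ) where
  A : Matrix (Fin d) (Fin d) ℝ
  N : Measure (E d)
  b : E d
  posSemidef : A.PosSemidef
  measure_zero : N {0} = 0
  lintegral_lt_top : ∫⁻ z, ENNReal.ofReal (min 1 (‖z‖ ^ 2)) ∂N < ∞

namespace LevyTriplet

variable {d : ℕ} (τ : LevyTriplet d)

/-- The matrix `A` acting on `ℝ^d`; its norm is the Euclidean operator norm. -/
def op : E d →L[ℝ] E d := Matrix.toEuclideanCLM (𝕜 := ℝ) τ.A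

/-- The quadratic form `⟨x, Ax⟩`. -/
def quad (x : E d) : ℝ := inner ℝ x (τ.op x)

open Classical in
/-- The Lévy–Khintchine exponent
`ψ(x) = ⟨x,Ax⟩ - i⟨x,b⟩ - ∫ (e^{i⟨x,z⟩} - 1 - i⟨x,z⟩ 1_{|z|<1}) N(dz)`. -/
def psi (x : E d) : ℂ :=
  (τ.quad x : ℂ) - Complex.I * (inner ℝ x τ.b : ℝ)
    - ∫ z, (Complex.exp (Complex.I * (inner ℝ x z : ℝ)) - 1
        - (if ‖z‖ < 1 then Complex.I * (inner ℝ x z : ℝ) else 0)) ∂τ.N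

/-- `ψ*(r) = sup_{|z| ≤ r} Re ψ(z)`. -/
def psiStar (r : ℝ) : ℝ := sSup ((fun z => (τ.psi z).re) '' Metric.closedBall (0 : E d) r)

/-- The concentration function `h(r) = r⁻²‖A‖ + ∫ (1 ∧ |z|²/r²) N(dz)`, `r > 0`. -/
def h (r : ℝ) : ℝ := (r ^ 2)⁻¹ * ‖τ.op‖ + ∫ z, min 1 (‖z‖ ^ 2 / r ^ 2) ∂τ.N

/-- The inverse of `h : (0,∞) → (0,∞)`. (When `h(0⁺) = ∞` this function is a bijection.) -/
def hInv (u : ℝ) : ℝ := Function.invFunOn τ.h (Set.Ioi 0) u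

/-- `τ` is the generating triplet of `Y`: `𝔼 e^{i⟨x,Y_t⟩} = e^{-tψ(x)}` for all `t ≥ 0`, `x`. -/
def Generates {Ω : Type*} [MeasurableSpace Ω] (Y : ℝ≥0 → Ω → E d) (P : Measure Ω) : Prop :=
  ∀ (t : ℝ≥0) (x : E d), charFun (P.map (Y t)) x = Complex.exp (-((t : ℝ) : ℂ) * τ.psi x)

/-- `p` is a transition density of `Y`: for every `t > 0`, `p(t,·)` is a density of `Y_t` with
respect to the Lebesgue measure. -/
def IsTransitionDensity {Ω : Type*} [MeasurableSpace Ω] (Y : ℝ≥0 → Ω → E d) (P : Measure Ω)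
    (p : ℝ≥0 → E d → ℝ≥0∞) : Prop :=
  ∀ t, 0 < t → Measurable (p t) ∧ P.map (Y t) = volume.withDensity (p t)

/-- Condition (C1) with time horizon `T ∈ (0,∞]`. Densities being determined only up to null sets,
the supremum is that of a suitable version. -/
def C1 {Ω : Type*} [MeasurableSpace Ω] (Y : ℝ≥0 → Ω → E d) (P : Measure Ω) (T : ℝ≥0∞) : Prop :=
  ∃ p, IsTransitionDensity Y P p ∧ ∃ c : ℝ, 0 < c ∧ ∀ t : ℝ≥0, 0 < t → (t : ℝ≥0∞) < T →
    (⨆ x, p t x) ≤ ENNReal.ofReal (c * (τ.hInv (1 / (t : ℝ)) ^ d)⁻¹)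

/-- Condition (C2) with time horizon `T ∈ (0,∞]`. -/
def C2 (T : ℝ≥0∞) : Prop :=
  ∃ c : ℝ, 0 < c ∧ ∀ t : ℝ≥0, 0 < t → (t : ℝ≥0∞) < T →
    (∫⁻ z : E d, ENNReal.ofReal (Real.exp (-(t : ℝ) * (τ.psi z).re)))
      ≤ ENNReal.ofReal (c * (τ.hInv (1 / (t : ℝ)) ^ d)⁻¹)

/-- Condition (C3) with `T ∈ (0,∞]`; `1/T = 0` if `T = ∞`. -/
def C3 (T : ℝ≥0∞) : Prop :=
  ∃ c α : ℝ, 0 < c ∧ c ≤ 1 ∧ 0 < α ∧ α ≤ 2 ∧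
    (∀ x : E d, T⁻¹ < ENNReal.ofReal ‖x‖ → c * τ.psiStar ‖x‖ ≤ (τ.psi x).re) ∧
    ∀ l r : ℝ, 1 ≤ l → T⁻¹ < ENNReal.ofReal r → c * l ^ α * τ.psiStar r ≤ τ.psiStar (l * r)

/-- Condition (C4) with `T ∈ (0,∞]`; `1/T = 0` if `T = ∞`. -/
def C4 (T : ℝ≥0∞) : Prop :=
  ∃ c : ℝ, 1 ≤ c ∧ ∀ x : E d, T⁻¹ < ENNReal.ofReal ‖x‖ →
    τ.psiStar ‖x‖ ≤ c * (τ.quad x + ∫ z in {z : E d | |inner ℝ x z| < 1}, (inner ℝ x z) ^ 2 ∂τ.N)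

end LevyTriplet

end LevySmallTime

end

/-!
Put `H(r) = h(1/r)`, `φ = Re ψ`, and `V(t) = ∫ exp(-t φ)`. Since `1 - cos u ≤ 2 (1 ∧ u²)`, and since
averaging `1 - cos (s u)` over `s ∈ [0, 1]` bounds `1 ∧ u²` from above, `ψ*` and `H` are comparable
(`psiStar_le_conc`, `conc_le_psiStar`), so every condition can be stated with `H`. At the time
`t = 1 / H(r)` one has `h⁻¹(1/t) = 1/r`, so the integral condition reads `V(1/H(r)) ≤ c r^d` for all
`r` beyond a threshold, which is `0` exactly when the time horizon is infinite. All implications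
between the last three conditions keep the threshold.

* The integral bound limits the volume of the sublevel sets `{φ ≤ K H(r)}` to a multiple of `r^d`.
  A ball of radius `B r` with `B` large does not fit, which forces `H(B r) ≥ 2 H(r)`
  (`exists_doubling`) and thus power growth of `H`. As `√φ` is subadditive up to constants, a point
  `x` with `φ(x)` much smaller than `H(‖x‖)` would put many disjoint balls around the multiples of
  `x` into such a set (`exists_conc_le_rePsi`).
* Conversely, comparability and power growth bound `exp(-φ/H(r))` by a stretched exponential of
  `‖x‖/r` (`ScalingBound.integralBound`).
* Under power growth, `φ(l x) ≤ l² G(x) + 2 H(‖x‖)`, with `G` the truncated moment, makes the last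
  term negligible for large `l` (`ScalingBound.momentBound`). Conversely
  `F(x) = ⟨x, Ax⟩ + ∫ u²/(1 + u²) dN`, `u = ⟨x, z⟩`, satisfies `F(2x) - F(x) ≥ (3/10) G(x)`, so a
  lower bound on `G` makes `F` grow geometrically (`MomentBound.scalingBound`).
* Densities and integrals are linked by Gaussian regularization. A probability measure with
  integrable characteristic function is dominated by a multiple of Lebesgue measure
  (`le_smul_volume_of_lintegral_charFun_le`), and one with density at most `M` satisfies
  `∫ |μ̂|² ≤ (2π)^d M` (`lintegral_norm_sq_charFun_le`). The latter controls `V(2t)` instead of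
  `V(t)`; that weaker bound already implies the doubling property of `H`, which closes the gap
  (`C1.C2`).
-/

namespace LevySmallTime
namespace LevyTriplet

variable {d : ℕ} (τ : LevyTriplet d)

/-! ### Integrability with respect to the Lévy measure -/

theorem integrable_min_one_norm_sq : Integrable (fun z : E d => min 1 (‖z‖ ^ 2)) τ.N := by
  refine ⟨by fun_prop, ?_⟩
  rw [hasFiniteIntegral_iff_ofReal (.of_forall fun z => by positivity)]
  exact τ.lintegral_lt_top

theorem integrable_of_norm_le {F : Type*} [NormedAddCommGroup F] {f : E d → F}
    (hf : AEStronglyMeasurable f τ.N) (C : ℝ) (h : ∀ z, ‖f z‖ ≤ C * min 1 (‖z‖ ^ 2)) :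
    Integrable f τ.N :=
  (τ.integrable_min_one_norm_sq.const_mul C).mono' hf (.of_forall h)

theorem ae_ne_zero : ∀ᵐ z ∂τ.N, z ≠ 0 := by
  rw [ae_iff]; simpa using τ.measure_zero

/-- Needed for Tonelli's theorem; `N` itself may be infinite near the origin. -/
instance : SFinite τ.N := by
  set f : E d → ℝ≥0∞ := fun z => ENNReal.ofReal (min 1 (‖z‖ ^ 2)) with hf
  have hm : Measurable f := by fun_prop
  have : IsFiniteMeasure (τ.N.withDensity f) := isFiniteMeasure_withDensity τ.lintegral_lt_top.ne
  have h := withDensity_inv_same₀ (μ := τ.N) (f := f) hm.aemeasurable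
    (by filter_upwards [τ.ae_ne_zero] with z hz; simp [hf, hz]) (by simp [hf])
  rw [← h]; infer_instance

theorem min_one_mul_le {a b : ℝ} (ha : 0 ≤ a) (hb : 0 ≤ b) :
    min 1 (a * b) ≤ (1 + a) * min 1 b := by
  rcases le_total 1 b with h | h
  · rw [min_eq_left h]; exact (min_le_left _ _).trans (by linarith)
  · rw [min_eq_right h]; exact (min_le_right _ _).trans (by nlinarith)

theorem inner_sq_le (x z : E d) : (inner ℝ x z) ^ 2 ≤ ‖x‖ ^ 2 * ‖z‖ ^ 2 := by
  rw [← mul_pow, ← sq_abs]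
  exact pow_le_pow_left₀ (abs_nonneg _) (abs_real_inner_le_norm x z) 2

theorem integrable_of_abs_le_inner {f : E d → ℝ} (hf : AEStronglyMeasurable f τ.N) (x : E d)
    (C : ℝ) (hC : 0 ≤ C) (h : ∀ z, |f z| ≤ C * min 1 ((inner ℝ x z) ^ 2)) :
    Integrable f τ.N := by
  refine τ.integrable_of_norm_le hf (C * (1 + ‖x‖ ^ 2)) fun z => (h z).trans ?_
  rw [mul_assoc]
  gcongr
  exact (min_le_min_left 1 (inner_sq_le x z)).trans (min_one_mul_le (by positivity) (by positivity))

theorem one_sub_cos_le (u : ℝ) : 1 - Real.cos u ≤ 2 * min 1 (u ^ 2) := by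
  rw [mul_min_of_nonneg _ _ (by norm_num : (0:ℝ) ≤ 2)]
  refine le_min (by linarith [Real.neg_one_le_cos u]) ?_
  nlinarith [Real.one_sub_sq_div_two_le_cos (x := u), sq_nonneg u]

theorem integrable_one_sub_cos (x : E d) :
    Integrable (fun z => 1 - Real.cos (inner ℝ x z)) τ.N := by
  refine τ.integrable_of_abs_le_inner (by fun_prop) x 2 (by norm_num) fun z => ?_
  rw [abs_of_nonneg (by linarith [Real.cos_le_one (inner ℝ x z)])]
  exact one_sub_cos_le _

theorem norm_exp_I_mul_sub_le (u : ℝ) :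
    ‖Complex.exp (Complex.I * u) - 1 - Complex.I * u‖ ≤ 3 * u ^ 2 := by
  rcases le_total |u| 1 with h | h
  · refine (Complex.norm_exp_sub_one_sub_id_le (by simpa using h)).trans ?_
    simp only [norm_mul, Complex.norm_I, one_mul, Complex.norm_real, Real.norm_eq_abs, sq_abs]
    nlinarith [sq_nonneg u]
  · have h1 : ‖Complex.exp (Complex.I * u)‖ = 1 := by
      rw [mul_comm]; exact Complex.norm_exp_ofReal_mul_I u
    have h2 := norm_sub_le (Complex.exp (Complex.I * u) - 1) (Complex.I * u)
    have h3 := norm_sub_le (Complex.exp (Complex.I * u)) 1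
    have h4 : ‖Complex.I * (u : ℂ)‖ = |u| := by simp
    rw [h1, norm_one] at h3
    rw [h4] at h2
    nlinarith [sq_abs u]

open Classical in
theorem integrable_psi_integrand (x : E d) :
    Integrable (fun z : E d => Complex.exp (Complex.I * (inner ℝ x z : ℝ)) - 1
        - (if ‖z‖ < 1 then Complex.I * (inner ℝ x z : ℝ) else 0)) τ.N := by
  refine τ.integrable_of_norm_le ?_ (3 * ‖x‖ ^ 2 + 2) fun z => ?_
  · refine Measurable.aestronglyMeasurable ?_
    refine Measurable.sub (by fun_prop) (Measurable.ite ?_ (by fun_prop) (by fun_prop))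
    exact measurableSet_lt (by fun_prop) (by fun_prop)
  · split_ifs with h
    · have hz : ‖z‖ ^ 2 ≤ 1 := by nlinarith [norm_nonneg z]
      rw [min_eq_right hz]
      refine (norm_exp_I_mul_sub_le _).trans ?_
      nlinarith [inner_sq_le x z, sq_nonneg ‖z‖]
    · have hz : 1 ≤ ‖z‖ ^ 2 := by nlinarith
      rw [min_eq_left hz, sub_zero]
      have h1 : ‖Complex.exp (Complex.I * (inner ℝ x z : ℝ))‖ = 1 := by
        rw [mul_comm]; exact Complex.norm_exp_ofReal_mul_I _
      have h3 := norm_sub_le (Complex.exp (Complex.I * (inner ℝ x z : ℝ))) 1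
      rw [h1, norm_one] at h3
      nlinarith [sq_nonneg ‖x‖]

theorem re_psi (x : E d) :
    (τ.psi x).re = τ.quad x + ∫ z, (1 - Real.cos (inner ℝ x z)) ∂τ.N := by
  have key := integral_re (𝕜 := ℂ) (τ.integrable_psi_integrand x)
  rw [psi, Complex.sub_re, Complex.sub_re]
  have h1 : (Complex.I * ((inner ℝ x τ.b : ℝ) : ℂ)).re = 0 := by simp
  rw [h1, Complex.ofReal_re, sub_zero, sub_eq_add_neg]
  congr 1
  rw [← RCLike.re_eq_complex_re, ← key, ← integral_neg]
  refine integral_congr_ae (.of_forall fun z => ?_)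
  have h2 : (Complex.exp (Complex.I * (inner ℝ x z : ℝ))).re = Real.cos (inner ℝ x z) := by
    rw [mul_comm]; exact Complex.exp_ofReal_mul_I_re _
  simp only [RCLike.re_eq_complex_re, Complex.sub_re, Complex.one_re]
  rw [h2]
  split_ifs <;> simp

/-! ### The Gaussian part -/

theorem op_isPositive : τ.op.toLinearMap.IsPositive :=
  Matrix.isPositive_toEuclideanLin_iff.2 τ.posSemidef

theorem quad_nonneg (x : E d) : 0 ≤ τ.quad x := by
  have := τ.op_isPositive.2 x
  simpa [quad, real_inner_comm] using this

theorem quad_le (x : E d) : τ.quad x ≤ ‖x‖ ^ 2 * ‖τ.op‖ := by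
  refine (real_inner_le_norm _ _).trans ?_
  nlinarith [τ.op.le_opNorm x, norm_nonneg x]

theorem quad_smul (c : ℝ) (x : E d) : τ.quad (c • x) = c ^ 2 * τ.quad x := by
  simp [quad, inner_smul_left, inner_smul_right]; ring

theorem quad_add_le (x y : E d) : τ.quad (x + y) ≤ 2 * τ.quad x + 2 * τ.quad y := by
  have := τ.quad_nonneg (x - y)
  simp only [quad, map_add, map_sub, inner_add_left, inner_add_right, inner_sub_left,
    inner_sub_right] at this ⊢
  linarith

/-- The norm of the Gaussian part is controlled by its quadratic form on a sphere. -/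
theorem norm_op_le {r M : ℝ} (hr : 0 < r) (h : ∀ x : E d, ‖x‖ = r → τ.quad x ≤ M) (hM : 0 ≤ M) :
    r ^ 2 * ‖τ.op‖ ≤ M := by
  have hsym : τ.op.IsSymmetric := τ.op_isPositive.1
  rw [τ.op.norm_eq_iSup_rayleighQuotient hsym, ← le_div_iff₀' (by positivity)]
  refine ciSup_le fun x => ?_
  by_cases hx : x = 0
  · subst hx; simp [ContinuousLinearMap.rayleighQuotient]; positivity
  · have hx' : 0 < ‖x‖ := norm_pos_iff.2 hx
    have h1 := h ((r / ‖x‖) • x) (by rw [norm_smul]; simp [abs_of_pos hr]; field_simp)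
    rw [quad_smul] at h1
    have h2 : τ.op.rayleighQuotient x = τ.quad x / ‖x‖ ^ 2 := by
      simp [ContinuousLinearMap.rayleighQuotient, ContinuousLinearMap.reApplyInnerSelf, quad,
        real_inner_comm]
    rw [h2, abs_of_nonneg (div_nonneg (τ.quad_nonneg x) (by positivity)),
      le_div_iff₀ (by positivity)]
    refine le_trans (le_of_eq ?_) h1
    field_simp

/-! ### The concentration function on the Fourier side -/

/-- The concentration function read on the Fourier side: `conc r = h (1 / r)`. It is increasing. -/
noncomputable def conc (r : ℝ) : ℝ := r ^ 2 * ‖τ.op‖ + ∫ z, min 1 (r ^ 2 * ‖z‖ ^ 2) ∂τ.N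

theorem h_eq_conc_inv (r : ℝ) : τ.h r = τ.conc r⁻¹ := by
  simp [h, conc, div_eq_inv_mul]

theorem integrable_conc (r : ℝ) : Integrable (fun z : E d => min 1 (r ^ 2 * ‖z‖ ^ 2)) τ.N := by
  refine τ.integrable_of_norm_le (by fun_prop) (1 + r ^ 2) fun z => ?_
  rw [Real.norm_of_nonneg (by positivity)]
  exact min_one_mul_le (by positivity) (by positivity)

theorem conc_nonneg (r : ℝ) : 0 ≤ τ.conc r :=
  add_nonneg (by positivity) (integral_nonneg fun z => by positivity)

theorem conc_mono {r s : ℝ} (hr : 0 ≤ r) (hrs : r ≤ s) : τ.conc r ≤ τ.conc s := by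
  unfold conc
  have := integral_mono (τ.integrable_conc r) (τ.integrable_conc s) fun z => by
    dsimp only; gcongr
  gcongr

theorem conc_zero : τ.conc 0 = 0 := by simp [conc]

theorem continuous_conc : Continuous τ.conc := by
  unfold conc
  refine Continuous.add (by fun_prop) (continuous_iff_continuousAt.2 fun r => ?_)
  refine continuousAt_of_dominated (bound := fun z => (1 + (|r| + 1) ^ 2) * min 1 (‖z‖ ^ 2))
    (.of_forall fun s => by fun_prop) ?_ (τ.integrable_min_one_norm_sq.const_mul _)
    (.of_forall fun z => by fun_prop)
  filter_upwards [(continuous_abs.tendsto r).eventually_lt_const (lt_add_one |r|)] with s hs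
  refine .of_forall fun z => ?_
  rw [Real.norm_of_nonneg (by positivity)]
  refine (min_one_mul_le (by positivity) (by positivity)).trans ?_
  have : s ^ 2 ≤ (|r| + 1) ^ 2 := by rw [← sq_abs s]; gcongr
  gcongr

theorem tendsto_conc (hinf : Tendsto τ.h (𝓝[>] 0) atTop) : Tendsto τ.conc atTop atTop := by
  refine (hinf.comp tendsto_inv_atTop_nhdsGT_zero).congr fun r => ?_
  simp [h_eq_conc_inv]

theorem conc_strictMono (hinf : Tendsto τ.h (𝓝[>] 0) atTop) {r s : ℝ} (hr : 0 < r) (hrs : r < s) :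
    τ.conc r < τ.conc s := by
  refine lt_of_le_of_ne (τ.conc_mono hr.le hrs.le) fun heq => ?_
  have hle := integral_mono (τ.integrable_conc r) (τ.integrable_conc s) fun z => by
    dsimp only; gcongr
  have hlt : r ^ 2 < s ^ 2 := by gcongr
  have hn : ‖τ.op‖ = 0 := by
    unfold conc at heq
    nlinarith [norm_nonneg τ.op]
  have hint : ∫ z, (min 1 (s ^ 2 * ‖z‖ ^ 2) - min 1 (r ^ 2 * ‖z‖ ^ 2)) ∂τ.N = 0 := by
    rw [integral_sub (τ.integrable_conc s) (τ.integrable_conc r)]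
    simp only [conc, hn] at heq
    linarith
  -- If the two values agree, `N` does not charge `{0 < r‖z‖ < 1}`, so that `conc` is bounded.
  rw [integral_eq_zero_iff_of_nonneg
    (fun z => sub_nonneg.2 (by dsimp only; gcongr))
    ((τ.integrable_conc s).sub (τ.integrable_conc r))] at hint
  have hae : ∀ᵐ z ∂τ.N, 1 ≤ r ^ 2 * ‖z‖ ^ 2 := by
    filter_upwards [hint, τ.ae_ne_zero] with z hz hz0
    by_contra! hlt1
    have hz' : 0 < ‖z‖ ^ 2 := by positivity
    have h1 : r ^ 2 * ‖z‖ ^ 2 < s ^ 2 * ‖z‖ ^ 2 := by gcongr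
    have h2 : r ^ 2 * ‖z‖ ^ 2 < min 1 (s ^ 2 * ‖z‖ ^ 2) := lt_min hlt1 h1
    simp only [Pi.zero_apply, min_eq_right hlt1.le] at hz
    linarith
  have hconst : ∀ᶠ ρ in atTop, τ.conc ρ ≤ τ.conc r := by
    filter_upwards [eventually_ge_atTop r] with ρ hρ
    simp only [conc, hn]
    refine le_of_eq (congrArg₂ _ (by simp) (integral_congr_ae ?_))
    filter_upwards [hae] with z hz
    rw [min_eq_left hz, min_eq_left (hz.trans (by gcongr))]
  obtain ⟨ρ, h1, h2⟩ := (hconst.and ((τ.tendsto_conc hinf).eventually_gt_atTop (τ.conc r))).exists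
  linarith

theorem conc_pos (hinf : Tendsto τ.h (𝓝[>] 0) atTop) {r : ℝ} (hr : 0 < r) : 0 < τ.conc r :=
  (τ.conc_nonneg (r / 2)).trans_lt (τ.conc_strictMono hinf (by linarith) (by linarith))

theorem conc_surjective (hinf : Tendsto τ.h (𝓝[>] 0) atTop) {u : ℝ} (hu : 0 < u) :
    ∃ r, 0 < r ∧ τ.conc r = u := by
  obtain ⟨R, hR, hR0⟩ := (((τ.tendsto_conc hinf).eventually_ge_atTop u).and
    (eventually_gt_atTop 0)).exists
  obtain ⟨r, hr, hru⟩ := intermediate_value_Icc hR0.le τ.continuous_conc.continuousOn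
    (show u ∈ Set.Icc (τ.conc 0) (τ.conc R) from ⟨by rw [conc_zero]; exact hu.le, hR⟩)
  refine ⟨r, lt_of_le_of_ne hr.1 ?_, hru⟩
  rintro rfl
  rw [conc_zero] at hru
  exact hu.ne hru

theorem lt_of_conc_lt {r s : ℝ} (hs : 0 ≤ s) (h : τ.conc r < τ.conc s) : r < s := by
  by_contra! hc
  exact absurd (τ.conc_mono hs hc) (not_le.2 h)

/-- `hInv` is the genuine inverse of `h`: the value `h⁻¹(conc r)` is `1 / r`. -/
theorem hInv_conc (hinf : Tendsto τ.h (𝓝[>] 0) atTop) {r : ℝ} (hr : 0 < r) :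
    τ.hInv (τ.conc r) = r⁻¹ := by
  have hex : ∃ s ∈ Set.Ioi (0 : ℝ), τ.h s = τ.conc r :=
    ⟨r⁻¹, inv_pos.2 hr, by rw [h_eq_conc_inv, inv_inv]⟩
  have hpos : 0 < τ.hInv (τ.conc r) := Function.invFunOn_mem hex
  have heq : τ.h (τ.hInv (τ.conc r)) = τ.conc r := Function.invFunOn_eq hex
  rw [h_eq_conc_inv] at heq
  rw [← inv_inj, inv_inv]
  rcases lt_trichotomy (τ.hInv (τ.conc r))⁻¹ r with h | h | h
  · exact absurd heq (τ.conc_strictMono hinf (inv_pos.2 hpos) h).ne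
  · exact h
  · exact absurd heq (τ.conc_strictMono hinf hr h).ne'

/-! ### The real part of the exponent -/

/-- The real part of the Lévy–Khintchine exponent. -/
noncomputable def rePsi (x : E d) : ℝ := (τ.psi x).re

theorem rePsi_eq (x : E d) :
    τ.rePsi x = τ.quad x + ∫ z, (1 - Real.cos (inner ℝ x z)) ∂τ.N := τ.re_psi x

theorem quad_le_rePsi (x : E d) : τ.quad x ≤ τ.rePsi x := by
  rw [rePsi_eq]
  exact le_add_of_nonneg_right (integral_nonneg fun z => by
    simpa using Real.cos_le_one (inner ℝ x z))

theorem rePsi_nonneg (x : E d) : 0 ≤ τ.rePsi x := (τ.quad_nonneg x).trans (τ.quad_le_rePsi x)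

theorem rePsi_le_conc {x : E d} {r : ℝ} (hx : ‖x‖ ≤ r) : τ.rePsi x ≤ 2 * τ.conc r := by
  have hr : 0 ≤ r := (norm_nonneg x).trans hx
  refine le_trans ?_ (mul_le_mul_of_nonneg_left (τ.conc_mono (norm_nonneg x) hx) zero_le_two)
  rw [rePsi_eq, conc, mul_add, ← integral_const_mul]
  refine add_le_add ?_ (integral_mono (τ.integrable_one_sub_cos x)
    ((τ.integrable_conc _).const_mul 2) fun z => ?_)
  · linarith [τ.quad_le x, τ.quad_nonneg x]
  · refine (one_sub_cos_le _).trans ?_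
    have := inner_sq_le x z
    gcongr

theorem one_sub_cos_eq (u : ℝ) : 1 - Real.cos u = 2 * Real.sin (u / 2) ^ 2 := by
  have := Real.cos_sq' (u / 2)
  have h2 := Real.cos_two_mul (u / 2)
  rw [mul_div_cancel₀ u (two_ne_zero)] at h2
  linarith

theorem one_sub_cos_add_le (a b : ℝ) :
    1 - Real.cos (a + b) ≤ 2 * (1 - Real.cos a) + 2 * (1 - Real.cos b) := by
  rw [one_sub_cos_eq, one_sub_cos_eq, one_sub_cos_eq, add_div, Real.sin_add]
  have h1 := Real.sin_sq_add_cos_sq (a / 2)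
  have h2 := Real.sin_sq_add_cos_sq (b / 2)
  have h3 := sq_nonneg (Real.sin (a/2) * Real.cos (b/2) - Real.cos (a/2) * Real.sin (b/2))
  have h4 := mul_nonneg (sq_nonneg (Real.sin (a/2))) (sq_nonneg (Real.sin (b/2)))
  nlinarith

theorem one_sub_cos_nat_mul_le (n : ℕ) (u : ℝ) :
    1 - Real.cos (n * u) ≤ n ^ 2 * (1 - Real.cos u) := by
  have hs : ∀ v : ℝ, |Real.sin (n * v)| ≤ n * |Real.sin v| := fun v => by
    induction n with
    | zero => simp
    | succ n ih =>
      push_cast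
      rw [add_mul, one_mul, Real.sin_add, add_mul, one_mul]
      refine (abs_add_le _ _).trans ?_
      rw [abs_mul, abs_mul]
      have h1 := Real.abs_cos_le_one v
      have h2 := Real.abs_cos_le_one (n * v)
      exact add_le_add ((mul_le_of_le_one_right (abs_nonneg _) h1).trans ih)
        (mul_le_of_le_one_left (abs_nonneg _) h2)
  rw [one_sub_cos_eq, one_sub_cos_eq, mul_div_assoc, ← sq_abs (Real.sin (n * (u / 2))),
    ← sq_abs (Real.sin (u / 2))]
  have := pow_le_pow_left₀ (abs_nonneg _) (hs (u / 2)) 2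
  linarith [mul_pow (n : ℝ) |Real.sin (u / 2)| 2]

theorem rePsi_add_le (x y : E d) : τ.rePsi (x + y) ≤ 2 * τ.rePsi x + 2 * τ.rePsi y := by
  have hx := τ.integrable_one_sub_cos x
  have hy := τ.integrable_one_sub_cos y
  have := integral_mono (τ.integrable_one_sub_cos (x + y)) ((hx.const_mul 2).add (hy.const_mul 2))
    fun z => by
      simpa [inner_add_left] using one_sub_cos_add_le (inner ℝ x z) (inner ℝ y z)
  simp only [Pi.add_apply] at this
  rw [integral_add (hx.const_mul 2) (hy.const_mul 2), integral_const_mul,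
    integral_const_mul] at this
  rw [rePsi_eq, rePsi_eq, rePsi_eq]
  linarith [τ.quad_add_le x y]

theorem rePsi_nat_smul_le (n : ℕ) (x : E d) : τ.rePsi ((n : ℝ) • x) ≤ n ^ 2 * τ.rePsi x := by
  have := integral_mono (τ.integrable_one_sub_cos ((n : ℝ) • x))
    ((τ.integrable_one_sub_cos x).const_mul (n ^ 2 : ℝ)) fun z => by
      simpa [inner_smul_left] using one_sub_cos_nat_mul_le n (inner ℝ x z)
  rw [integral_const_mul] at this
  rw [rePsi_eq, rePsi_eq, quad_smul]
  linarith

/-! ### Comparison of `ψ*` with the concentration function -/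

theorem bddAbove_rePsi_image (r : ℝ) :
    BddAbove ((fun z => (τ.psi z).re) '' Metric.closedBall (0 : E d) r) := by
  refine ⟨2 * τ.conc r, ?_⟩
  rintro _ ⟨x, hx, rfl⟩
  exact τ.rePsi_le_conc (by simpa using hx)

theorem rePsi_le_psiStar {x : E d} {r : ℝ} (hx : ‖x‖ ≤ r) : τ.rePsi x ≤ τ.psiStar r :=
  le_csSup (τ.bddAbove_rePsi_image r) ⟨x, by simpa using hx, rfl⟩

theorem psiStar_le_conc {r : ℝ} (hr : 0 ≤ r) : τ.psiStar r ≤ 2 * τ.conc r := by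
  refine csSup_le ⟨_, 0, by simpa using hr, rfl⟩ ?_
  rintro _ ⟨x, hx, rfl⟩
  exact τ.rePsi_le_conc (by simpa using hx)

theorem psiStar_nonneg {r : ℝ} (hr : 0 ≤ r) : 0 ≤ τ.psiStar r :=
  (τ.rePsi_nonneg 0).trans (τ.rePsi_le_psiStar (by simpa using hr))

theorem min_one_sq_le_integral_one_sub_cos (a : ℝ) :
    min 1 (a ^ 2) ≤ 15 * ∫ s in (0 : ℝ)..1, (1 - Real.cos (s * a)) := by
  by_cases ha : a = 0
  · simp [ha]
  have hint : ∫ s in (0 : ℝ)..1, (1 - Real.cos (s * a)) = 1 - Real.sin a / a := by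
    rw [intervalIntegral.integral_sub (by simp) (by
      exact (Continuous.intervalIntegrable (by fun_prop) _ _))]
    simp [intervalIntegral.integral_comp_mul_right (fun x => Real.cos x) ha]
    field_simp
  -- For `|a| ≤ 2` use the quadratic lower bound of `1 - cos`, for `|a| ≥ 2` the exact value
  -- `1 - sin a / a` of the integral.
  rcases le_total |a| 2 with h | h
  · have hle : ∫ s in (0 : ℝ)..1, (2 / Real.pi ^ 2 * (s * a) ^ 2)
        ≤ ∫ s in (0 : ℝ)..1, (1 - Real.cos (s * a)) := by
      refine intervalIntegral.integral_mono_on zero_le_one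
        (Continuous.intervalIntegrable (by fun_prop) _ _)
        (Continuous.intervalIntegrable (by fun_prop) _ _) fun s hs => ?_
      have := Real.cos_le_one_sub_mul_cos_sq (x := s * a) (by
        rw [abs_mul, abs_of_nonneg hs.1]
        nlinarith [Real.pi_gt_three, hs.2, abs_nonneg a])
      linarith
    have hval : ∫ s in (0 : ℝ)..1, (2 / Real.pi ^ 2 * (s * a) ^ 2)
        = 2 * a ^ 2 / (3 * Real.pi ^ 2) := by
      simp only [mul_pow, ← mul_assoc]
      rw [intervalIntegral.integral_mul_const, intervalIntegral.integral_const_mul, integral_pow]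
      norm_num
      field_simp
    have hpi : Real.pi ^ 2 ≤ 10 := by nlinarith [Real.pi_lt_d2, Real.pi_pos]
    have h15 : a ^ 2 / 15 ≤ 2 * a ^ 2 / (3 * Real.pi ^ 2) := by
      rw [div_le_div_iff₀ (by norm_num) (by positivity)]
      nlinarith [sq_nonneg a]
    refine (min_le_right _ _).trans ?_
    linarith
  · have h1 : Real.sin a / a ≤ 1 / 2 := by
      refine (le_abs_self _).trans ?_
      rw [abs_div, div_le_div_iff₀ (by linarith) (by norm_num)]
      linarith [Real.abs_sin_le_one a]
    refine (min_le_left _ _).trans ?_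
    rw [hint]; linarith

/-- Averaging `1 - cos ⟨s e, z⟩` over `s ∈ (0, 1]` dominates `1 ∧ ⟨e, z⟩²`, and `Re ψ (s e)` stays
below `ψ*`. -/
theorem integral_min_one_inner_sq_le {e : E d} {r : ℝ} (he : ‖e‖ ≤ r) :
    ∫ z, min 1 ((inner ℝ e z) ^ 2) ∂τ.N ≤ 15 * τ.psiStar r := by
  have hr : 0 ≤ r := (norm_nonneg e).trans he
  have hM := τ.psiStar_nonneg hr
  have hint : Integrable (fun z => min 1 ((inner ℝ e z : ℝ) ^ 2)) τ.N :=
    τ.integrable_of_abs_le_inner (by fun_prop) e 1 zero_le_one fun z => by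
      rw [one_mul, abs_of_nonneg (by positivity)]
  have hcos : ∀ u : ℝ, 0 ≤ 1 - Real.cos u := fun u => by linarith [Real.cos_le_one u]
  rw [← ENNReal.ofReal_le_ofReal_iff (by positivity),
    ofReal_integral_eq_lintegral_ofReal hint (.of_forall fun z => by positivity)]
  calc ∫⁻ z, ENNReal.ofReal (min 1 ((inner ℝ e z) ^ 2)) ∂τ.N
      ≤ ∫⁻ z, (ENNReal.ofReal 15 * ∫⁻ s in Set.Ioc (0 : ℝ) 1,
          ENNReal.ofReal (1 - Real.cos (s * inner ℝ e z))) ∂τ.N := by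
        refine lintegral_mono fun z => ?_
        refine (ENNReal.ofReal_le_ofReal (min_one_sq_le_integral_one_sub_cos _)).trans ?_
        rw [ENNReal.ofReal_mul (by norm_num), intervalIntegral.integral_of_le zero_le_one,
          ofReal_integral_eq_lintegral_ofReal
            (Continuous.integrableOn_Ioc (by fun_prop)) (.of_forall fun s => hcos _)]
    _ = ENNReal.ofReal 15 * ∫⁻ s in Set.Ioc (0 : ℝ) 1, ∫⁻ z,
          ENNReal.ofReal (1 - Real.cos (s * inner ℝ e z)) ∂τ.N := by
        rw [lintegral_const_mul' _ _ ENNReal.ofReal_ne_top, lintegral_lintegral_swap]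
        exact Measurable.aemeasurable (by fun_prop)
    _ ≤ ENNReal.ofReal 15 * ∫⁻ s in Set.Ioc (0 : ℝ) 1, ENNReal.ofReal (τ.psiStar r) := by
        gcongr 1
        refine setLIntegral_mono measurable_const fun s hs => ?_
        have hs1 : ‖s • e‖ ≤ r := by
          rw [norm_smul, Real.norm_of_nonneg hs.1.le]
          nlinarith [hs.2, norm_nonneg e]
        have h1 := τ.integrable_one_sub_cos (s • e)
        simp only [inner_smul_left, conj_trivial] at h1
        rw [← ofReal_integral_eq_lintegral_ofReal h1 (.of_forall fun z => hcos _)]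
        refine ENNReal.ofReal_le_ofReal (le_trans ?_ (τ.rePsi_le_psiStar hs1))
        rw [rePsi_eq]
        simp only [inner_smul_left, conj_trivial]
        exact le_add_of_nonneg_left (τ.quad_nonneg _)
    _ = ENNReal.ofReal (15 * τ.psiStar r) := by
        rw [ENNReal.ofReal_mul (by norm_num)]; simp

theorem min_one_sum_le {ι : Type*} (s : Finset ι) (a : ι → ℝ) (ha : ∀ i, 0 ≤ a i) :
    min 1 (∑ i ∈ s, a i) ≤ ∑ i ∈ s, min 1 (a i) := by
  by_cases h : ∃ i ∈ s, 1 ≤ a i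
  · obtain ⟨i, hi, h1⟩ := h
    refine (min_le_left _ _).trans ?_
    have := Finset.single_le_sum (f := fun i => min 1 (a i))
      (fun j _ => le_min zero_le_one (ha j)) hi
    simpa [min_eq_left h1] using this
  · push Not at h
    refine (min_le_right _ _).trans (le_of_eq (Finset.sum_congr rfl fun i hi => ?_))
    rw [min_eq_right (h i hi).le]

theorem conc_le_psiStar {r : ℝ} (hr : 0 < r) : τ.conc r ≤ (1 + 15 * d) * τ.psiStar r := by
  have h1 : r ^ 2 * ‖τ.op‖ ≤ τ.psiStar r :=
    τ.norm_op_le hr (fun x hx => (τ.quad_le_rePsi x).trans (τ.rePsi_le_psiStar hx.le))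
      (τ.psiStar_nonneg hr.le)
  let e : Fin d → E d := fun i => r • EuclideanSpace.single i (1 : ℝ)
  have he : ∀ i, ‖e i‖ ≤ r := fun i => by simp [e, norm_smul, abs_of_pos hr]
  have hint : ∀ i, Integrable (fun z => min 1 ((inner ℝ (e i) z : ℝ) ^ 2)) τ.N := fun i =>
    τ.integrable_of_abs_le_inner (by fun_prop) (e i) 1 zero_le_one fun z => by
      rw [one_mul, abs_of_nonneg (by positivity)]
  have h2 : ∫ z, min 1 (r ^ 2 * ‖z‖ ^ 2) ∂τ.N ≤ ∑ i, ∫ z, min 1 ((inner ℝ (e i) z) ^ 2) ∂τ.N := by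
    rw [← integral_finsetSum _ fun i _ => hint i]
    refine integral_mono (τ.integrable_conc r) (integrable_finsetSum _ fun i _ => hint i)
      fun z => ?_
    have hz : r ^ 2 * ‖z‖ ^ 2 = ∑ i, (inner ℝ (e i) z : ℝ) ^ 2 := by
      simp [e, inner_smul_left, EuclideanSpace.inner_single_left, mul_pow, ← Finset.mul_sum,
        EuclideanSpace.real_norm_sq_eq]
    dsimp only
    rw [hz]
    exact min_one_sum_le _ _ fun i => sq_nonneg _
  have h3 : ∑ i, ∫ z, min 1 ((inner ℝ (e i) z) ^ 2) ∂τ.N ≤ ∑ _i : Fin d, 15 * τ.psiStar r :=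
    Finset.sum_le_sum fun i _ => τ.integral_min_one_inner_sq_le (he i)
  simp only [Finset.sum_const, Finset.card_univ, Fintype.card_fin, nsmul_eq_mul] at h3
  rw [conc]
  linarith

/-! ### The truncated second moment in a direction -/

/-- The quantity `⟨x, Ax⟩ + ∫_{|⟨x,z⟩| < 1} ⟨x,z⟩² N(dz)`. -/
noncomputable def truncMoment (x : E d) : ℝ :=
  τ.quad x + ∫ z in {z : E d | |inner ℝ x z| < 1}, (inner ℝ x z) ^ 2 ∂τ.N

/-- A smooth directional analogue of the concentration function,
`⟨x, Ax⟩ + ∫ ⟨x,z⟩² / (1 + ⟨x,z⟩²) N(dz)`. -/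
noncomputable def dirConc (x : E d) : ℝ :=
  τ.quad x + ∫ z, (inner ℝ x z) ^ 2 / (1 + (inner ℝ x z) ^ 2) ∂τ.N

theorem measurableSet_abs_inner_lt (x : E d) : MeasurableSet {z : E d | |inner ℝ x z| < 1} :=
  measurableSet_lt (by fun_prop) (by fun_prop)

theorem truncMoment_eq (x : E d) : τ.truncMoment x = τ.quad x +
    ∫ z, {z : E d | |inner ℝ x z| < 1}.indicator (fun z => (inner ℝ x z) ^ 2) z ∂τ.N := by
  rw [truncMoment, integral_indicator (measurableSet_abs_inner_lt x)]

theorem integrable_indicator_inner_sq (x : E d) :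
    Integrable ({z : E d | |inner ℝ x z| < 1}.indicator (fun z => (inner ℝ x z : ℝ) ^ 2)) τ.N := by
  refine τ.integrable_of_abs_le_inner
    (Measurable.aestronglyMeasurable
      (Measurable.indicator (by fun_prop) (measurableSet_abs_inner_lt x))) x 1 zero_le_one
    fun z => ?_
  by_cases hz : |inner ℝ x z| < 1
  · have h1 : (inner ℝ x z : ℝ) ^ 2 ≤ 1 := by
      rw [← sq_abs]; nlinarith [abs_nonneg (inner ℝ x z : ℝ)]
    rw [Set.indicator_of_mem (by exact hz), one_mul, min_eq_right h1, abs_of_nonneg (sq_nonneg _)]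
  · rw [Set.indicator_of_notMem (by exact hz), abs_zero]; positivity

theorem integrable_dirConc (x : E d) :
    Integrable (fun z => (inner ℝ x z : ℝ) ^ 2 / (1 + (inner ℝ x z : ℝ) ^ 2)) τ.N := by
  refine τ.integrable_of_abs_le_inner (Measurable.aestronglyMeasurable (by fun_prop)) x 1
    zero_le_one fun z => ?_
  rw [abs_of_nonneg (by positivity), one_mul, div_le_iff₀ (by positivity)]
  rcases le_total 1 ((inner ℝ x z : ℝ) ^ 2) with h | h
  · rw [min_eq_left h]; linarith
  · rw [min_eq_right h]; nlinarith [sq_nonneg (inner ℝ x z : ℝ)]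

theorem truncMoment_nonneg (x : E d) : 0 ≤ τ.truncMoment x :=
  add_nonneg (τ.quad_nonneg x) (integral_nonneg fun _ => sq_nonneg _)

theorem truncMoment_le_rePsi (x : E d) : τ.truncMoment x ≤ 5 * τ.rePsi x := by
  have := integral_mono (τ.integrable_indicator_inner_sq x)
    ((τ.integrable_one_sub_cos x).const_mul 5) fun z => by
      refine Set.indicator_le' (g := fun z => 5 * (1 - Real.cos (inner ℝ x z))) (fun z hz => ?_)
        (fun z _ => ?_) z
      · have h1 := Real.cos_le_one_sub_mul_cos_sq (x := inner ℝ x z)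
          ((show |inner ℝ x z| < 1 from hz).le.trans (by linarith [Real.pi_gt_three]))
        have hpi : 1 / 5 ≤ 2 / Real.pi ^ 2 := by
          rw [div_le_div_iff₀ (by norm_num) (by positivity)]
          nlinarith [Real.pi_lt_d2, Real.pi_pos]
        nlinarith [sq_nonneg (inner ℝ x z : ℝ)]
      · simpa using Real.cos_le_one (inner ℝ x z)
  rw [integral_const_mul] at this
  rw [truncMoment_eq, rePsi_eq]
  linarith [τ.quad_nonneg x]

theorem truncMoment_le_dirConc (x : E d) : τ.truncMoment x ≤ 2 * τ.dirConc x := by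
  have := integral_mono (τ.integrable_indicator_inner_sq x)
    ((τ.integrable_dirConc x).const_mul 2) fun z => by
      refine Set.indicator_le' (g := fun z => 2 * ((inner ℝ x z : ℝ) ^ 2 /
        (1 + (inner ℝ x z : ℝ) ^ 2))) (fun z hz => ?_) (fun z _ => ?_) z
      · have h1 : (inner ℝ x z : ℝ) ^ 2 < 1 := by
          rw [← sq_abs]; nlinarith [abs_nonneg (inner ℝ x z : ℝ), show |inner ℝ x z| < 1 from hz]
        rw [← mul_div_assoc, le_div_iff₀ (by positivity)]
        nlinarith [sq_nonneg (inner ℝ x z : ℝ)]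
      · positivity
  rw [integral_const_mul] at this
  rw [truncMoment_eq, dirConc]
  linarith [τ.quad_nonneg x]

theorem dirConc_le_conc (x : E d) : τ.dirConc x ≤ τ.conc ‖x‖ := by
  refine add_le_add (τ.quad_le x)
    (integral_mono (τ.integrable_dirConc x) (τ.integrable_conc _) fun z => ?_)
  refine le_min ?_ (le_trans ?_ (inner_sq_le x z))
  · exact div_le_one_of_le₀ (by linarith) (by positivity)
  · exact div_le_self (sq_nonneg _) (by nlinarith [sq_nonneg (inner ℝ x z : ℝ)])

/-- The increment of `dirConc` along a doubling is governed by the truncated second moment: this is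
the discrete form of the differential inequality that yields power growth. -/
theorem truncMoment_le_dirConc_two_smul (x : E d) :
    τ.dirConc x + 3 / 10 * τ.truncMoment x ≤ τ.dirConc ((2 : ℝ) • x) := by
  have := integral_mono (((τ.integrable_indicator_inner_sq x).const_mul (3 / 10)).add
    (τ.integrable_dirConc x)) (τ.integrable_dirConc ((2 : ℝ) • x)) fun z => by
      simp only [Pi.add_apply, inner_smul_left, conj_trivial]
      set u : ℝ := inner ℝ x z with hu
      have hu0 := sq_nonneg u
      by_cases hz : |u| < 1
      · rw [Set.indicator_of_mem (by exact hz), ← hu]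
        have h1 : u ^ 2 < 1 := by rw [← sq_abs]; nlinarith [abs_nonneg u]
        have h2 : (2 * u) ^ 2 / (1 + (2 * u) ^ 2) - u ^ 2 / (1 + u ^ 2)
            = 3 * u ^ 2 / ((1 + 4 * u ^ 2) * (1 + u ^ 2)) := by
          field_simp; ring
        have h3 : 3 / 10 * u ^ 2 ≤ 3 * u ^ 2 / ((1 + 4 * u ^ 2) * (1 + u ^ 2)) := by
          rw [le_div_iff₀ (by positivity)]
          have : (1 + 4 * u ^ 2) * (1 + u ^ 2) ≤ 10 := by nlinarith
          nlinarith
        linarith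
      · rw [Set.indicator_of_notMem (by exact hz), mul_zero, zero_add,
          div_le_div_iff₀ (by positivity) (by positivity)]
        nlinarith
  simp only [Pi.add_apply] at this
  rw [integral_add ((τ.integrable_indicator_inner_sq x).const_mul (3 / 10))
    (τ.integrable_dirConc x), integral_const_mul] at this
  rw [truncMoment_eq, dirConc, dirConc, quad_smul]
  linarith [τ.quad_nonneg x]

theorem rePsi_smul_le (x : E d) (l : ℝ) :
    τ.rePsi (l • x) ≤ l ^ 2 * τ.truncMoment x + 2 * τ.conc ‖x‖ := by
  have := integral_mono (τ.integrable_one_sub_cos (l • x))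
    (((τ.integrable_indicator_inner_sq x).const_mul (l ^ 2)).add
      ((τ.integrable_conc ‖x‖).const_mul 2)) fun z => by
      simp only [Pi.add_apply, inner_smul_left, conj_trivial]
      set u : ℝ := inner ℝ x z with hu
      by_cases hz : |u| < 1
      · rw [Set.indicator_of_mem (by exact hz), ← hu]
        have h1 : 0 ≤ min 1 (‖x‖ ^ 2 * ‖z‖ ^ 2) := by positivity
        nlinarith [Real.one_sub_sq_div_two_le_cos (x := l * u), sq_nonneg (l * u)]
      · rw [Set.indicator_of_notMem (by exact hz), mul_zero, zero_add]
        have h1 : 1 ≤ u ^ 2 := by rw [← sq_abs]; nlinarith [not_lt.1 hz]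
        rw [min_eq_left (h1.trans (inner_sq_le x z))]
        linarith [Real.neg_one_le_cos (l * u)]
  simp only [Pi.add_apply] at this
  rw [integral_add ((τ.integrable_indicator_inner_sq x).const_mul (l ^ 2))
    ((τ.integrable_conc ‖x‖).const_mul 2), integral_const_mul, integral_const_mul] at this
  rw [truncMoment_eq, rePsi_eq, quad_smul, conc]
  nlinarith [mul_nonneg (sq_nonneg ‖x‖) (norm_nonneg τ.op)]

/-! ### Integrals of `exp(-t Re ψ)`, scaling and truncated moments -/

/-- The integral `∫ exp(-t Re ψ(z)) dz`. -/
noncomputable def expInt (t : ℝ) : ℝ≥0∞ :=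
  ∫⁻ z : E d, ENNReal.ofReal (Real.exp (-t * τ.rePsi z))

theorem expInt_anti {s t : ℝ} (hst : s ≤ t) : τ.expInt t ≤ τ.expInt s := by
  refine lintegral_mono fun z => ENNReal.ofReal_le_ofReal (Real.exp_le_exp.2 ?_)
  nlinarith [τ.rePsi_nonneg z]

theorem ofReal_exp_mul_volume_le_expInt {S : Set (E d)} (hS : MeasurableSet S) {t K : ℝ}
    (h : ∀ x ∈ S, t * τ.rePsi x ≤ K) :
    ENNReal.ofReal (Real.exp (-K)) * volume S ≤ τ.expInt t := by
  calc ENNReal.ofReal (Real.exp (-K)) * volume S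
      = ∫⁻ _ in S, ENNReal.ofReal (Real.exp (-K)) := by rw [setLIntegral_const]
    _ ≤ ∫⁻ z in S, ENNReal.ofReal (Real.exp (-t * τ.rePsi z)) :=
        setLIntegral_mono' hS fun z hz =>
          ENNReal.ofReal_le_ofReal (Real.exp_le_exp.2 (by linarith [h z hz]))
    _ ≤ _ := setLIntegral_le_lintegral _ _

/-- The volume of the unit ball of `ℝ^d`, as a real number. -/
noncomputable def unitBallVolume (d : ℕ) : ℝ := (volume (Metric.ball (0 : E d) 1)).toReal

theorem unitBallVolume_pos (d : ℕ) : 0 < unitBallVolume d :=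
  ENNReal.toReal_pos (Metric.measure_ball_pos volume _ one_pos).ne' measure_ball_lt_top.ne

theorem volume_ball_eq (x : E d) {r : ℝ} (hr : 0 < r) :
    volume (Metric.ball x r) = ENNReal.ofReal (r ^ d * unitBallVolume d) := by
  rw [Measure.addHaar_ball_of_pos volume x hr, ENNReal.ofReal_mul (by positivity), unitBallVolume,
    ENNReal.ofReal_toReal measure_ball_lt_top.ne, finrank_euclideanSpace_fin]

/-- If `∫ exp(-t Re ψ) ≤ c r^d` at a time `t` comparable with `1 / conc r`, the ball of radius
`B r` cannot lie in a sublevel set of `Re ψ` at height of order `conc r`, so `conc` at least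
doubles between `r` and `B r`. -/
theorem exists_doubling (hd : 1 ≤ d) (hinf : Tendsto τ.h (𝓝[>] 0) atTop) {c : ℝ} (hc : 0 < c) :
    ∃ B : ℝ, 1 < B ∧ ∀ r, 0 < r →
      τ.expInt (2 / τ.conc r) ≤ ENNReal.ofReal (c * r ^ d) → 2 * τ.conc r ≤ τ.conc (B * r) := by
  have hω := unitBallVolume_pos d
  set ω := unitBallVolume d with hωd
  -- The choice of `B` ensures `exp (-8) * ω * B > c`.
  refine ⟨1 + c * Real.exp 8 / ω, by have := Real.exp_pos 8; simp; positivity, fun r hr hle => ?_⟩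
  set B := 1 + c * Real.exp 8 / ω with hB
  have hB1 : 1 ≤ B := by rw [hB]; simp; positivity
  by_contra! hlt
  have hH := τ.conc_pos hinf hr
  have h1 := τ.ofReal_exp_mul_volume_le_expInt (S := Metric.ball 0 (B * r)) measurableSet_ball
    (t := 2 / τ.conc r) (K := 8) fun x hx => by
      have hx' : ‖x‖ ≤ B * r := by simpa using (Metric.mem_ball.1 hx).le
      have := τ.rePsi_le_conc hx'
      rw [div_mul_eq_mul_div, div_le_iff₀ hH]
      linarith
  rw [volume_ball_eq _ (by positivity), ← ENNReal.ofReal_mul (Real.exp_pos _).le] at h1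
  have h2 := (ENNReal.ofReal_le_ofReal_iff (by positivity)).1 (h1.trans hle)
  rw [← hωd, mul_pow, Real.exp_neg] at h2
  have h3 : B ≤ B ^ d := le_self_pow₀ hB1 (by omega)
  have h4 : (Real.exp 8)⁻¹ * (B ^ d * ω) ≤ c := by
    have hrd : 0 < r ^ d := by positivity
    refine le_of_mul_le_mul_right (le_trans (le_of_eq ?_) h2) hrd
    ring
  have h5 : B ^ d * ω ≤ c * Real.exp 8 := by
    rwa [inv_mul_le_iff₀ (Real.exp_pos 8), mul_comm (Real.exp 8)] at h4
  have h6 : B * ω = ω + c * Real.exp 8 := by rw [hB]; field_simp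
  nlinarith

/-- The bound `∫ exp(-t Re ψ) ≤ c ρ^d` at the times `t = 1 / conc ρ` with `ρ > R`. -/
def IntegralBound (R : ℝ) : Prop :=
  ∃ c, 0 < c ∧ ∀ r, R < r → τ.expInt (1 / τ.conc r) ≤ ENNReal.ofReal (c * r ^ d)

/-- Comparability of `Re ψ` with the concentration function, and weak lower scaling of the latter,
beyond `R`. -/
def ScalingBound (R : ℝ) : Prop :=
  ∃ c α : ℝ, 0 < c ∧ c ≤ 1 ∧ 0 < α ∧ α ≤ 2 ∧ (∀ x : E d, R < ‖x‖ → c * τ.conc ‖x‖ ≤ τ.rePsi x) ∧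
    ∀ l r : ℝ, 1 ≤ l → R < r → c * l ^ α * τ.conc r ≤ τ.conc (l * r)

/-- The concentration function is dominated by the truncated second moment in every direction,
beyond `R`. -/
def MomentBound (R : ℝ) : Prop :=
  ∃ c, 0 < c ∧ ∀ x : E d, R < ‖x‖ → τ.conc ‖x‖ ≤ c * τ.truncMoment x

/-- Growth along a geometric sequence gives weak lower scaling with a positive exponent. -/
theorem exists_rpow_scaling {f : ℝ → ℝ} (hmono : ∀ r s, 0 ≤ r → r ≤ s → f r ≤ f s)
    (hf : ∀ r, 0 ≤ f r) {B K c R : ℝ} (hB : 1 < B) (hK : 1 < K) (hc : 0 < c) (hR : 0 ≤ R)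
    (h : ∀ r, R < r → ∀ n : ℕ, c * K ^ n * f r ≤ f (B ^ n * r)) :
    ∃ c' α : ℝ, 0 < c' ∧ c' ≤ 1 ∧ 0 < α ∧ α ≤ 2 ∧
      ∀ l r : ℝ, 1 ≤ l → R < r → c' * l ^ α * f r ≤ f (l * r) := by
  have hα : 0 < min 2 (Real.logb B K) := lt_min two_pos (Real.logb_pos hB hK)
  refine ⟨min 1 (c / K), min 2 (Real.logb B K), by positivity, min_le_left _ _, hα,
    min_le_left _ _, fun l r hl hr => ?_⟩
  set α := min 2 (Real.logb B K)
  obtain ⟨n, hn1, hn2⟩ := exists_nat_pow_near hl hB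
  have hBα : B ^ α ≤ K := by
    calc B ^ α ≤ B ^ Real.logb B K := Real.rpow_le_rpow_of_exponent_le hB.le (min_le_right _ _)
      _ = K := Real.rpow_logb (by linarith) hB.ne' (by linarith)
  have hlα : l ^ α ≤ K ^ (n + 1) := by
    calc l ^ α ≤ (B ^ (n + 1)) ^ α := Real.rpow_le_rpow (by linarith) hn2.le hα.le
      _ = (B ^ α) ^ (n + 1) := by
        rw [← Real.rpow_natCast, ← Real.rpow_natCast, ← Real.rpow_mul (by linarith),
          ← Real.rpow_mul (by linarith), mul_comm]
      _ ≤ K ^ (n + 1) := pow_le_pow_left₀ (by positivity) hBα _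
  calc min 1 (c / K) * l ^ α * f r ≤ c / K * K ^ (n + 1) * f r := by
        have := hf r
        gcongr
        exact min_le_right _ _
    _ = c * K ^ n * f r := by rw [pow_succ]; field_simp
    _ ≤ f (B ^ n * r) := h r hr n
    _ ≤ f (l * r) := hmono _ _ (mul_nonneg (by positivity) (by linarith))
        (mul_le_mul_of_nonneg_right hn1 (by linarith))

/-- If `Re ψ x` were much smaller than `conc ‖x‖`, many disjoint balls centred at multiples of `x`
would lie in a sublevel set of `Re ψ`, which is too small to contain them. -/
theorem exists_conc_le_rePsi (hinf : Tendsto τ.h (𝓝[>] 0) atTop) {c : ℝ} :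
    ∃ c', 0 < c' ∧ ∀ x : E d, x ≠ 0 →
      τ.expInt (1 / τ.conc ‖x‖) ≤ ENNReal.ofReal (c * ‖x‖ ^ d) →
        c' * τ.conc ‖x‖ ≤ τ.rePsi x := by
  have hω := unitBallVolume_pos d
  set ω := unitBallVolume d with hωd
  obtain ⟨n, hn⟩ := exists_nat_gt (max 1 (c * Real.exp 6 * 2 ^ d / ω))
  have hn1 : (1 : ℝ) < n := (le_max_left _ _).trans_lt hn
  have hn2 : c * Real.exp 6 * 2 ^ d / ω < n := (le_max_right _ _).trans_lt hn
  refine ⟨1 / n ^ 2, by positivity, fun x hx hle => ?_⟩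
  -- With `n² Re ψ x < conc ‖x‖`, the union of `n` balls of radius `‖x‖ / 2` around `k x`, `k < n`,
  -- lies in `{Re ψ ≤ 6 conc ‖x‖}`, and its volume exceeds what the integral bound allows.
  by_contra! hlt
  have hr : 0 < ‖x‖ := norm_pos_iff.2 hx
  have hH := τ.conc_pos hinf hr
  have hlt' : (n : ℝ) ^ 2 * τ.rePsi x < τ.conc ‖x‖ := by
    rw [one_div, inv_mul_eq_div, lt_div_iff₀ (by positivity)] at hlt
    linarith
  let S : Set (E d) := ⋃ k ∈ Finset.range n, Metric.ball ((k : ℝ) • x) (‖x‖ / 2)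
  have hS : MeasurableSet S := Finset.measurableSet_biUnion _ fun k _ => measurableSet_ball
  have hvol : volume S = ENNReal.ofReal (n * ((‖x‖ / 2) ^ d * ω)) := by
    rw [measure_biUnion_finset _ fun k _ => measurableSet_ball]
    · simp only [volume_ball_eq _ (half_pos hr), Finset.sum_const, Finset.card_range, nsmul_eq_mul]
      rw [ENNReal.ofReal_mul (p := (n : ℝ)) (by positivity), ENNReal.ofReal_natCast]
    · intro j _ k _ hjk
      refine Metric.ball_disjoint_ball ?_
      rw [dist_eq_norm, ← sub_smul, norm_smul, Real.norm_eq_abs]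
      have : (1 : ℝ) ≤ |(j : ℝ) - k| := by
        have h1 : (1 : ℤ) ≤ |(j : ℤ) - k| := Int.one_le_abs (by omega)
        exact_mod_cast h1
      nlinarith
  have h1 := τ.ofReal_exp_mul_volume_le_expInt hS (t := 1 / τ.conc ‖x‖) (K := 6) fun y hy => by
    simp only [S, Set.mem_iUnion, Finset.mem_range] at hy
    obtain ⟨k, hk, hy⟩ := hy
    have h2 := τ.rePsi_add_le ((k : ℝ) • x) (y - (k : ℝ) • x)
    rw [add_sub_cancel] at h2
    have h3 := τ.rePsi_nat_smul_le k x
    have h4 : τ.rePsi (y - (k : ℝ) • x) ≤ 2 * τ.conc ‖x‖ := by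
      refine τ.rePsi_le_conc ?_
      rw [← dist_eq_norm]
      linarith [Metric.mem_ball.1 hy]
    have hkn : (k : ℝ) ^ 2 ≤ n ^ 2 := by gcongr
    have h5 := mul_le_mul_of_nonneg_right hkn (τ.rePsi_nonneg x)
    rw [one_div_mul_eq_div, div_le_iff₀ hH]
    linarith
  rw [hvol, ← ENNReal.ofReal_mul (Real.exp_pos _).le] at h1
  have hpos : 0 < Real.exp (-6) * (n * ((‖x‖ / 2) ^ d * ω)) := by positivity
  have h2 : Real.exp (-6) * (n * ((‖x‖ / 2) ^ d * ω)) ≤ c * ‖x‖ ^ d := by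
    by_contra! hcon
    exact absurd (h1.trans hle) (not_le.2 ((ENNReal.ofReal_lt_ofReal_iff hpos).2 hcon))
  rw [Real.exp_neg, inv_mul_le_iff₀ (Real.exp_pos 6), div_pow] at h2
  rw [div_lt_iff₀ hω] at hn2
  have hrd : 0 < ‖x‖ ^ d := by positivity
  have h3 : n * (‖x‖ ^ d / 2 ^ d * ω) = ‖x‖ ^ d * (n * ω) / 2 ^ d := by ring
  rw [h3, div_le_iff₀ (by positivity)] at h2
  nlinarith

theorem IntegralBound.scalingBound (hd : 1 ≤ d) (hinf : Tendsto τ.h (𝓝[>] 0) atTop) {R : ℝ}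
    (hR : 0 ≤ R) (h : τ.IntegralBound R) : τ.ScalingBound R := by
  obtain ⟨c, hc, h⟩ := h
  obtain ⟨B, hB, hdoub⟩ := τ.exists_doubling hd hinf hc
  obtain ⟨c₁, hc₁, hlow⟩ := τ.exists_conc_le_rePsi hinf (c := c)
  have hdoub' : ∀ r, R < r → 2 * τ.conc r ≤ τ.conc (B * r) := fun r hr =>
    hdoub r (hR.trans_lt hr) ((τ.expInt_anti (by
      have := τ.conc_pos hinf (hR.trans_lt hr)
      gcongr; norm_num)).trans (h r hr))
  have hiter : ∀ r, R < r → ∀ n : ℕ, 1 * (2 : ℝ) ^ n * τ.conc r ≤ τ.conc (B ^ n * r) := by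
    intro r hr n
    induction n with
    | zero => simp
    | succ n ih =>
      have h1 : R < B ^ n * r := hr.trans_le
        (le_mul_of_one_le_left (hR.trans hr.le) (one_le_pow₀ hB.le))
      have h2 := hdoub' _ h1
      rw [← mul_assoc, ← pow_succ'] at h2
      rw [pow_succ']
      linarith
  obtain ⟨c₂, α, hc₂, hc₂', hα, hα', hs⟩ := exists_rpow_scaling
    (fun r s => τ.conc_mono) τ.conc_nonneg hB one_lt_two one_pos hR hiter
  refine ⟨min c₁ c₂, α, lt_min hc₁ hc₂, (min_le_right _ _).trans hc₂', hα, hα', fun x hx => ?_,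
    fun l r hl hr => ?_⟩
  · have hx0 : x ≠ 0 := norm_pos_iff.1 (hR.trans_lt hx)
    exact (mul_le_mul_of_nonneg_right (min_le_left _ _) (τ.conc_nonneg _)).trans
      (hlow x hx0 (h _ hx))
  · refine le_trans ?_ (hs l r hl hr)
    have := τ.conc_nonneg r
    gcongr
    exact min_le_right _ _

theorem integrable_exp_neg_mul_norm_rpow (hd : 1 ≤ d) {a α : ℝ} (ha : 0 < a) (hα : 0 < α) :
    Integrable (fun x : E d => Real.exp (-a * ‖x‖ ^ α)) := by
  have : Nonempty (Fin d) := ⟨⟨0, hd⟩⟩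
  rw [integrable_fun_norm_addHaar (volume : Measure (E d))
    (f := fun s : ℝ => Real.exp (-a * s ^ α)), finrank_euclideanSpace_fin]
  refine (integrableOn_rpow_mul_exp_neg_mul_rpow (s := ((d - 1 : ℕ) : ℝ)) (by
    have : (0 : ℝ) ≤ ((d - 1 : ℕ) : ℝ) := by positivity
    linarith) hα ha).congr_fun (fun s _ => ?_) measurableSet_Ioi
  simp [Real.rpow_natCast]

/-- After rescaling by `r`, the scaling bound dominates `exp(-Re ψ / conc r)` by a fixed integrable
function `e * exp(-c² ‖y‖ ^ α)`; the factor `e` covers the ball of radius `r`. -/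
theorem ScalingBound.integralBound (hd : 1 ≤ d) (hinf : Tendsto τ.h (𝓝[>] 0) atTop) {R : ℝ}
    (hR : 0 ≤ R) (h : τ.ScalingBound R) : τ.IntegralBound R := by
  obtain ⟨c, α, hc, hc1, hα, -, hlow, hs⟩ := h
  set w : E d → ℝ := fun y => Real.exp 1 * Real.exp (-c ^ 2 * ‖y‖ ^ α) with hw
  have hwi : Integrable w := (integrable_exp_neg_mul_norm_rpow hd (by positivity) hα).const_mul _
  refine ⟨(∫ y, w y) + 1, by
    have : 0 ≤ ∫ y, w y := integral_nonneg fun y => by positivity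
    linarith, fun r hr => ?_⟩
  have hr0 : 0 < r := hR.trans_lt hr
  have hH := τ.conc_pos hinf hr0
  have hpt : ∀ x : E d, Real.exp (-(1 / τ.conc r) * τ.rePsi x) ≤ w (r⁻¹ • x) := fun x => by
    rw [hw]
    dsimp only
    rw [← Real.exp_add, Real.exp_le_exp, norm_smul, Real.norm_of_nonneg (by positivity)]
    rcases le_total ‖x‖ r with hx | hx
    · have h1 : (r⁻¹ * ‖x‖) ^ α ≤ 1 :=
        Real.rpow_le_one (by positivity) (by rwa [inv_mul_le_iff₀ hr0, mul_one]) hα.le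
      have h2 : 0 ≤ 1 / τ.conc r * τ.rePsi x := mul_nonneg (by positivity) (τ.rePsi_nonneg x)
      have h3 : 0 ≤ (r⁻¹ * ‖x‖) ^ α := by positivity
      nlinarith
    · have h1 := hs (r⁻¹ * ‖x‖) r (by rwa [inv_mul_eq_div, one_le_div hr0]) hr
      rw [mul_comm _ r, mul_inv_cancel_left₀ hr0.ne'] at h1
      have h2 := hlow x (hr.trans_le hx)
      have h3 : c ^ 2 * (r⁻¹ * ‖x‖) ^ α ≤ 1 / τ.conc r * τ.rePsi x := by
        rw [one_div_mul_eq_div, le_div_iff₀ hH]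
        nlinarith
      linarith
  calc τ.expInt (1 / τ.conc r) ≤ ∫⁻ x, ENNReal.ofReal (w (r⁻¹ • x)) :=
        lintegral_mono fun x => ENNReal.ofReal_le_ofReal (hpt x)
    _ = ENNReal.ofReal (∫ x, w (r⁻¹ • x)) :=
        (ofReal_integral_eq_lintegral_ofReal (hwi.comp_smul (inv_ne_zero hr0.ne'))
          (.of_forall fun x => by positivity)).symm
    _ = ENNReal.ofReal ((∫ y, w y) * r ^ d) := by
        rw [Measure.integral_comp_inv_smul_of_nonneg _ _ hr0.le, finrank_euclideanSpace_fin,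
          smul_eq_mul, mul_comm]
    _ ≤ _ := ENNReal.ofReal_le_ofReal (by gcongr; linarith)

/-- Comparison at the point `l x` with `l` large: the jumps with `|⟨x, z⟩| ≥ 1` contribute at most
`2 conc ‖x‖`, which lower scaling makes negligible against `conc (l ‖x‖)`. -/
theorem ScalingBound.momentBound {R : ℝ} (hR : 0 ≤ R) (h : τ.ScalingBound R) : τ.MomentBound R := by
  obtain ⟨c, α, hc, hc1, hα, -, hlow, hs⟩ := h
  -- With `l ^ α = 4 / c ^ 2` the part of `Re ψ (l x)` due to `|⟨x, z⟩| ≥ 1` is at most half of it.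
  set l : ℝ := (4 / c ^ 2) ^ (1 / α) with hl
  have h4 : 1 ≤ 4 / c ^ 2 := by rw [one_le_div (by positivity)]; nlinarith
  have hl1 : 1 ≤ l := Real.one_le_rpow h4 (by positivity)
  have hlα : l ^ α = 4 / c ^ 2 := by
    rw [hl, ← Real.rpow_mul (by positivity), one_div_mul_cancel hα.ne', Real.rpow_one]
  refine ⟨2 * l ^ 2 / c, by positivity, fun x hx => ?_⟩
  have hx0 : 0 < ‖x‖ := hR.trans_lt hx
  have hnorm : ‖l • x‖ = l * ‖x‖ := by rw [norm_smul, Real.norm_of_nonneg (by linarith)]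
  have h1 := hs l ‖x‖ hl1 hx
  have h2 := hlow (l • x) (by rw [hnorm]; nlinarith)
  have h3 := τ.rePsi_smul_le x l
  have h5 := τ.conc_mono hx0.le (le_mul_of_one_le_left hx0.le hl1)
  rw [hnorm] at h2
  have h6 : 4 * τ.conc ‖x‖ ≤ c * τ.conc (l * ‖x‖) := by
    rw [hlα] at h1
    have : c * (4 / c ^ 2) * τ.conc ‖x‖ = 4 * τ.conc ‖x‖ / c := by field_simp
    rw [this, div_le_iff₀ hc] at h1
    linarith
  rw [div_mul_eq_mul_div, le_div_iff₀ hc]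
  nlinarith

/-- Each doubling multiplies `dirConc` by a factor larger than `1`, because the increment is at
least a multiple of the truncated moment, hence of `conc`, hence of `dirConc` itself. -/
theorem MomentBound.scalingBound (hd : 1 ≤ d) {R : ℝ} (hR : 0 ≤ R) (h : τ.MomentBound R) :
    τ.ScalingBound R := by
  obtain ⟨c, hc, h⟩ := h
  have hstep : ∀ x : E d, R < ‖x‖ →
      (1 + 3 / (10 * c)) * τ.dirConc x ≤ τ.dirConc ((2 : ℝ) • x) := fun x hx => by
    have h1 := τ.truncMoment_le_dirConc_two_smul x
    have h2 := (τ.dirConc_le_conc x).trans (h x hx)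
    have h3 : 3 / (10 * c) * τ.dirConc x ≤ 3 / 10 * τ.truncMoment x := by
      rw [div_mul_eq_mul_div, div_le_iff₀ (by positivity)]
      nlinarith
    linarith
  have hiter : ∀ (n : ℕ) (x : E d), R < ‖x‖ →
      (1 + 3 / (10 * c)) ^ n * τ.dirConc x ≤ τ.dirConc ((2 : ℝ) ^ n • x) := by
    intro n x hx
    induction n with
    | zero => simp
    | succ n ih =>
      have h1 : R < ‖(2 : ℝ) ^ n • x‖ := by
        rw [norm_smul, Real.norm_of_nonneg (by positivity)]
        exact hx.trans_le (le_mul_of_one_le_left (norm_nonneg _) (one_le_pow₀ one_le_two))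
      have h2 := hstep _ h1
      rw [smul_smul, ← pow_succ'] at h2
      refine le_trans ?_ h2
      rw [pow_succ', mul_assoc]
      gcongr
  have hgrow : ∀ r, R < r → ∀ n : ℕ,
      1 / (2 * c) * (1 + 3 / (10 * c)) ^ n * τ.conc r ≤ τ.conc (2 ^ n * r) := fun r hr n => by
    have hr0 : 0 < r := hR.trans_lt hr
    set x : E d := EuclideanSpace.single ⟨0, hd⟩ r with hx
    have hxr : ‖x‖ = r := by simp [hx, abs_of_pos hr0]
    have h1 := hiter n x (by rwa [hxr])
    have h2 := τ.dirConc_le_conc ((2 : ℝ) ^ n • x)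
    rw [norm_smul, Real.norm_of_nonneg (by positivity), hxr] at h2
    have h3 := h x (by rwa [hxr])
    rw [hxr] at h3
    have h4 := τ.truncMoment_le_dirConc x
    refine le_trans ?_ (h1.trans h2)
    rw [mul_comm (1 / (2 * c)), mul_assoc]
    gcongr
    rw [one_div_mul_eq_div, div_le_iff₀ (by positivity)]
    nlinarith
  obtain ⟨c₂, α, hc₂, hc₂', hα, hα', hs⟩ := exists_rpow_scaling
    (fun r s => τ.conc_mono) τ.conc_nonneg one_lt_two
    (lt_add_of_pos_right 1 (by positivity : 0 < 3 / (10 * c)))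
    (by positivity : 0 < 1 / (2 * c)) hR hgrow
  refine ⟨min (1 / (5 * c)) c₂, α, by positivity, (min_le_right _ _).trans hc₂', hα, hα',
    fun x hx => ?_, fun l r hl hr => ?_⟩
  · refine (mul_le_mul_of_nonneg_right (min_le_left _ _) (τ.conc_nonneg _)).trans ?_
    rw [one_div_mul_eq_div, div_le_iff₀ (by positivity)]
    have h1 := h x hx
    have h2 := mul_le_mul_of_nonneg_left (τ.truncMoment_le_rePsi x) hc.le
    linarith
  · refine le_trans ?_ (hs l r hl hr)
    have := τ.conc_nonneg r
    gcongr
    exact min_le_right _ _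

end LevyTriplet
end LevySmallTime

namespace LevySmallTime

variable {d : ℕ}

/-! ### Characteristic functions and bounded densities -/

/-- The Gaussian kernel `(π c)^(d/2) exp(-π² c ‖w‖²)`, of total mass `1`; it concentrates at `0` as
`c → ∞`. -/
noncomputable def gaussKer (d : ℕ) (c : ℝ) (w : E d) : ℝ :=
  (Real.pi * c) ^ ((d : ℝ) / 2) * Real.exp (-(Real.pi ^ 2 * c) * ‖w‖ ^ 2)

theorem gaussKer_nonneg {c : ℝ} (hc : 0 < c) (w : E d) : 0 ≤ gaussKer d c w := by
  unfold gaussKer; positivity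

theorem continuous_gaussKer (c : ℝ) : Continuous (gaussKer d c) := by
  unfold gaussKer; fun_prop

theorem measurable_gaussKer (c : ℝ) : Measurable (gaussKer d c) :=
  (continuous_gaussKer c).measurable

theorem integral_gaussKer {c : ℝ} (hc : 0 < c) : ∫ w, gaussKer d c w = 1 := by
  unfold gaussKer
  rw [integral_const_mul, GaussianFourier.integral_rexp_neg_mul_sq_norm (by positivity),
    finrank_euclideanSpace_fin, ← Real.mul_rpow (by positivity) (by positivity)]
  have : Real.pi * c * (Real.pi / (Real.pi ^ 2 * c)) = 1 := by field_simp
  rw [this, Real.one_rpow]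

theorem lintegral_gaussKer {c : ℝ} (hc : 0 < c) :
    ∫⁻ w, ENNReal.ofReal (gaussKer d c w) = 1 := by
  rw [← ofReal_integral_eq_lintegral_ofReal _ (.of_forall fun w => gaussKer_nonneg hc w),
    integral_gaussKer hc, ENNReal.ofReal_one]
  by_contra h
  have := integral_undef h
  rw [integral_gaussKer hc] at this
  exact one_ne_zero this

theorem integral_cexp_gaussian {c : ℝ} (hc : 0 < c) (w : E d) :
    ∫ ξ : E d, Complex.exp (-((4 * Real.pi ^ 2 * c)⁻¹ : ℝ) * ‖ξ‖ ^ 2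
        + Complex.I * (inner ℝ w ξ : ℝ))
      = (((2 * Real.pi) ^ d * gaussKer d c w : ℝ) : ℂ) := by
  rw [GaussianFourier.integral_cexp_neg_mul_sq_norm_add (by rw [Complex.ofReal_re]; positivity),
    finrank_euclideanSpace_fin, gaussKer, ← mul_assoc, Complex.ofReal_mul, Complex.ofReal_exp]
  congr 1
  · have h1 : (2 * Real.pi) ^ d * (Real.pi * c) ^ ((d : ℝ) / 2)
        = (Real.pi / (4 * Real.pi ^ 2 * c)⁻¹) ^ ((d : ℝ) / 2) := by
      have h2 : (2 * Real.pi) ^ d = ((2 * Real.pi) ^ 2) ^ ((d : ℝ) / 2) := by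
        rw [← Real.rpow_natCast, ← Real.rpow_natCast, ← Real.rpow_mul (by positivity)]
        congr 1; push_cast; ring
      rw [h2, ← Real.mul_rpow (by positivity) (by positivity)]
      congr 1
      rw [div_inv_eq_mul]; ring
    rw [h1, Complex.ofReal_cpow (by positivity)]
    push_cast
    rfl
  · congr 1
    push_cast
    rw [Complex.I_sq]
    have : (c : ℂ) ≠ 0 := by exact_mod_cast hc.ne'
    have : (Real.pi : ℂ) ≠ 0 := by exact_mod_cast Real.pi_ne_zero
    field_simp

theorem norm_cexp_gaussian (a : ℝ) (w ξ : E d) :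
    ‖Complex.exp (-(a : ℂ) * ‖ξ‖ ^ 2 + Complex.I * (inner ℝ w ξ : ℝ))‖
      = Real.exp (-a * ‖ξ‖ ^ 2) := by
  rw [Complex.norm_exp]
  congr 1
  simp [← Complex.ofReal_pow]

theorem integrable_exp_neg_mul_norm_sq {a : ℝ} (ha : 0 < a) :
    Integrable (fun ξ : E d => Real.exp (-a * ‖ξ‖ ^ 2)) := by
  have := (GaussianFourier.integrable_cexp_neg_mul_sq_norm_add (b := (a : ℂ)) (by simpa) Complex.I
    (0 : E d)).norm
  simpa only [norm_cexp_gaussian] using this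

/-- Parseval's identity against a Gaussian: the smoothed measure has a density which is the damped
inverse Fourier transform of the characteristic function. -/
theorem integral_gaussian_mul_charFun {c : ℝ} (hc : 0 < c) (μ : Measure (E d)) [IsFiniteMeasure μ]
    (y : E d) :
    ∫ ξ : E d, Complex.exp (-((4 * Real.pi ^ 2 * c)⁻¹ : ℝ) * ‖ξ‖ ^ 2
        + Complex.I * (inner ℝ (-y) ξ : ℝ)) * charFun μ ξ
      = (((2 * Real.pi) ^ d * ∫ x, gaussKer d c (x - y) ∂μ : ℝ) : ℂ) := by
  set a : ℝ := (4 * Real.pi ^ 2 * c)⁻¹ with ha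
  have ha0 : 0 < a := by positivity
  have hint : Integrable (Function.uncurry fun (ξ x : E d) =>
      Complex.exp (-(a : ℂ) * ‖ξ‖ ^ 2 + Complex.I * (inner ℝ (x - y) ξ : ℝ)))
      ((volume : Measure (E d)).prod μ) := by
    refine Integrable.mono' ((integrable_exp_neg_mul_norm_sq ha0).mul_prod
      (integrable_const (1 : ℝ) (μ := μ))) ?_ (.of_forall fun p => ?_)
    · refine Continuous.aestronglyMeasurable ?_
      unfold Function.uncurry
      fun_prop
    · rw [Function.uncurry, norm_cexp_gaussian, mul_one]
  calc ∫ ξ : E d, Complex.exp (-(a : ℂ) * ‖ξ‖ ^ 2 + Complex.I * (inner ℝ (-y) ξ : ℝ)) * charFun μ ξ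
      = ∫ ξ : E d, ∫ x, Complex.exp (-(a : ℂ) * ‖ξ‖ ^ 2
          + Complex.I * (inner ℝ (x - y) ξ : ℝ)) ∂μ := by
        refine integral_congr_ae (.of_forall fun ξ => ?_)
        dsimp only
        rw [charFun_apply, ← integral_const_mul]
        refine integral_congr_ae (.of_forall fun x => ?_)
        dsimp only
        rw [← Complex.exp_add]
        congr 1
        rw [inner_sub_left, inner_neg_left]
        push_cast
        ring
    _ = ∫ x, ((((2 * Real.pi) ^ d * gaussKer d c (x - y) : ℝ)) : ℂ) ∂μ := by
        rw [integral_integral_swap hint]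
        simp only [ha, integral_cexp_gaussian hc]
    _ = _ := by rw [integral_complex_ofReal, integral_const_mul]

/-- The characteristic function of the symmetrization of `μ`. -/
theorem charFun_conv_map_neg (μ : Measure (E d)) [IsFiniteMeasure μ] (ξ : E d) :
    charFun (μ ∗ μ.map Neg.neg) ξ = ((‖charFun μ ξ‖ ^ 2 : ℝ) : ℂ) := by
  have h : charFun (μ.map Neg.neg) ξ = charFun μ (-ξ) := by
    rw [charFun_apply, charFun_apply, integral_map measurable_neg.aemeasurable
      (Continuous.aestronglyMeasurable (by fun_prop))]
    simp
  rw [charFun_conv, h, charFun_neg, Complex.mul_conj, Complex.normSq_eq_norm_sq]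

/-- A probability measure with density at most `M` has a square integrable characteristic function:
symmetrize, test against a Gaussian and let the Gaussian flatten. -/
theorem lintegral_norm_sq_charFun_le (μ : Measure (E d)) [IsProbabilityMeasure μ] {M : ℝ}
    (hM : 0 ≤ M) (h : μ ≤ ENNReal.ofReal M • (volume : Measure (E d))) :
    ∫⁻ ξ, ENNReal.ofReal (‖charFun μ ξ‖ ^ 2) ≤ ENNReal.ofReal ((2 * Real.pi) ^ d * M) := by
  have hmeas : Measurable (charFun μ) := measurable_charFun
  set ν := μ ∗ μ.map Neg.neg with hν
  have : IsProbabilityMeasure (μ.map Neg.neg) :=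
    Measure.isProbabilityMeasure_map measurable_neg.aemeasurable
  have hνint : ∀ c, 0 < c → ∫ x, gaussKer d c (x - 0) ∂ν ≤ M := fun c hc => by
    have hg : Measurable fun x => ENNReal.ofReal (gaussKer d c x) :=
      (measurable_gaussKer c).ennreal_ofReal
    simp only [sub_zero]
    rw [integral_eq_lintegral_of_nonneg_ae (.of_forall fun w => gaussKer_nonneg hc w)
      (continuous_gaussKer c).aestronglyMeasurable]
    refine ENNReal.toReal_le_of_le_ofReal hM ?_
    rw [hν, Measure.conv_comm, Measure.lintegral_conv hg]
    calc ∫⁻ x, ∫⁻ y, ENNReal.ofReal (gaussKer d c (x + y)) ∂μ ∂(μ.map Neg.neg)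
        ≤ ∫⁻ _x, ENNReal.ofReal M ∂(μ.map Neg.neg) := by
          refine lintegral_mono fun x => ?_
          refine (lintegral_mono' h le_rfl).trans ?_
          rw [lintegral_smul_measure,
            lintegral_add_left_eq_self (fun y => ENNReal.ofReal (gaussKer d c y)) x,
            lintegral_gaussKer hc]
          simp
      _ = ENNReal.ofReal M := by simp
  have hdamp : ∀ c, 0 < c → ∫⁻ ξ : E d, ENNReal.ofReal
      (Real.exp (-(4 * Real.pi ^ 2 * c)⁻¹ * ‖ξ‖ ^ 2) * ‖charFun μ ξ‖ ^ 2)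
        ≤ ENNReal.ofReal ((2 * Real.pi) ^ d * M) := fun c hc => by
    have hkey := integral_gaussian_mul_charFun hc ν 0
    set a : ℝ := (4 * Real.pi ^ 2 * c)⁻¹ with ha
    have ha0 : 0 < a := by positivity
    have hrw : ∀ ξ : E d, Complex.exp (-(a : ℂ) * ‖ξ‖ ^ 2
          + Complex.I * (inner ℝ (-(0 : E d)) ξ : ℝ))
        * charFun ν ξ = ((Real.exp (-a * ‖ξ‖ ^ 2) * ‖charFun μ ξ‖ ^ 2 : ℝ) : ℂ) := fun ξ => by
      rw [charFun_conv_map_neg]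
      simp
    simp only [hrw] at hkey
    rw [integral_complex_ofReal, Complex.ofReal_inj] at hkey
    have hi : Integrable fun ξ : E d => Real.exp (-a * ‖ξ‖ ^ 2) * ‖charFun μ ξ‖ ^ 2 := by
      refine (integrable_exp_neg_mul_norm_sq ha0).mono' (Measurable.aestronglyMeasurable
        (by fun_prop)) (.of_forall fun ξ => ?_)
      rw [Real.norm_of_nonneg (by positivity)]
      exact mul_le_of_le_one_right (Real.exp_pos _).le
        (pow_le_one₀ (norm_nonneg _) (norm_charFun_le_one ξ))
    rw [← ofReal_integral_eq_lintegral_ofReal hi (.of_forall fun ξ => by positivity), hkey]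
    gcongr
    exact hνint c hc
  calc ∫⁻ ξ, ENNReal.ofReal (‖charFun μ ξ‖ ^ 2)
      = ∫⁻ ξ, liminf (fun n : ℕ => ENNReal.ofReal
          (Real.exp (-(4 * Real.pi ^ 2 * ((n : ℝ) + 1))⁻¹ * ‖ξ‖ ^ 2) * ‖charFun μ ξ‖ ^ 2))
          atTop := by
        refine lintegral_congr fun ξ => (Tendsto.liminf_eq ?_).symm
        refine ENNReal.tendsto_ofReal ?_
        have h1 : Tendsto (fun n : ℕ => (4 * Real.pi ^ 2 * ((n : ℝ) + 1))⁻¹) atTop (𝓝 0) :=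
          tendsto_inv_atTop_zero.comp ((tendsto_atTop_add_const_right _ _
            tendsto_natCast_atTop_atTop).const_mul_atTop (by positivity))
        have h2 : Tendsto (fun n : ℕ =>
            Real.exp (-(4 * Real.pi ^ 2 * ((n : ℝ) + 1))⁻¹ * ‖ξ‖ ^ 2)) atTop (𝓝 1) := by
          have := (Real.continuous_exp.tendsto _).comp (h1.neg.mul_const (‖ξ‖ ^ 2))
          simpa [Function.comp_def] using this
        simpa using h2.mul_const (‖charFun μ ξ‖ ^ 2)
    _ ≤ liminf (fun n : ℕ => ∫⁻ ξ, ENNReal.ofReal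
          (Real.exp (-(4 * Real.pi ^ 2 * ((n : ℝ) + 1))⁻¹ * ‖ξ‖ ^ 2) * ‖charFun μ ξ‖ ^ 2))
          atTop := lintegral_liminf_le fun n => by fun_prop
    _ ≤ _ := by
        refine liminf_le_of_frequently_le' (Frequently.of_forall fun n => ?_)
        exact hdamp _ (by positivity)

/-- The Gaussian averages of an open set tend to `1` at its points. -/
theorem one_le_liminf_lintegral_gaussKer {U : Set (E d)} (hU : IsOpen U) {x : E d} (hx : x ∈ U) :
    1 ≤ liminf (fun n : ℕ => ∫⁻ y in U,
      ENNReal.ofReal (gaussKer d ((n : ℝ) + 1) (x - y))) atTop := by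
  -- Passing to a bounded neighbourhood makes the indicator integrable.
  set W := U ∩ Metric.ball x 1
  have hWo : IsOpen W := hU.inter Metric.isOpen_ball
  have hxW : x ∈ W := ⟨hx, Metric.mem_ball_self one_pos⟩
  have hWf : volume W ≠ ∞ :=
    ((measure_mono Set.inter_subset_right).trans_lt measure_ball_lt_top).ne
  have hfi : Integrable (W.indicator fun _ => (1 : ℂ)) :=
    (integrable_indicator_iff hWo.measurableSet).2 (integrableOn_const hWf)
  have hfc : ContinuousAt (W.indicator fun _ => (1 : ℂ)) x := by
    refine (continuousAt_const (y := (1 : ℂ))).congr ?_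
    filter_upwards [hWo.mem_nhds hxW] with z hz
    rw [Set.indicator_of_mem hz]
  have hlim := (Real.tendsto_integral_gaussian_smul' hfi hfc).comp
    (tendsto_atTop_add_const_right _ (1 : ℝ) tendsto_natCast_atTop_atTop)
  rw [Set.indicator_of_mem hxW, finrank_euclideanSpace_fin] at hlim
  have hre := (Complex.continuous_re.tendsto _).comp hlim
  rw [Complex.one_re] at hre
  have heq : ∀ n : ℕ, ENNReal.ofReal ((∫ w : E d,
      ((Real.pi * (((n : ℝ) + 1 : ℝ) : ℂ)) ^ ((d : ℂ) / 2) *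
      Complex.exp (-Real.pi ^ 2 * (((n : ℝ) + 1 : ℝ) : ℂ) * ‖x - w‖ ^ 2)) •
        W.indicator (fun _ => (1 : ℂ)) w).re)
      ≤ ∫⁻ y in U, ENNReal.ofReal (gaussKer d ((n : ℝ) + 1) (x - y)) := fun n => by
    have hc : (0 : ℝ) < (n : ℝ) + 1 := by positivity
    have h1 : ∀ w : E d, ((Real.pi * (((n : ℝ) + 1 : ℝ) : ℂ)) ^ ((d : ℂ) / 2) *
        Complex.exp (-Real.pi ^ 2 * (((n : ℝ) + 1 : ℝ) : ℂ) * ‖x - w‖ ^ 2)) •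
        W.indicator (fun _ => (1 : ℂ)) w
        = ((W.indicator (fun w => gaussKer d ((n : ℝ) + 1) (x - w)) w : ℝ) : ℂ) := fun w => by
      by_cases hw : w ∈ W
      · rw [Set.indicator_of_mem hw, Set.indicator_of_mem hw, gaussKer, Complex.ofReal_mul,
          Complex.ofReal_cpow (by positivity), Complex.ofReal_exp]
        simp
      · rw [Set.indicator_of_notMem hw, Set.indicator_of_notMem hw]; simp
    simp only [h1]
    rw [integral_complex_ofReal, Complex.ofReal_re, integral_indicator hWo.measurableSet]
    rw [integral_eq_lintegral_of_nonneg_ae (.of_forall fun w => gaussKer_nonneg hc _)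
      ((continuous_gaussKer _).comp (by fun_prop)).aestronglyMeasurable]
    exact ENNReal.ofReal_toReal_le.trans (lintegral_mono_set Set.inter_subset_left)
  calc (1 : ℝ≥0∞) = liminf (fun n : ℕ => _) atTop :=
        (by simpa using (ENNReal.tendsto_ofReal hre).liminf_eq.symm)
    _ ≤ _ := liminf_le_liminf (.of_forall heq)

/-- The density of the smoothed measure is bounded by the `L¹` norm of the characteristic
function. -/
theorem lintegral_gaussKer_sub_le (μ : Measure (E d)) [IsProbabilityMeasure μ] {V : ℝ}
    (hV : 0 ≤ V) (h : ∫⁻ ξ, ENNReal.ofReal ‖charFun μ ξ‖ ≤ ENNReal.ofReal V) {c : ℝ} (hc : 0 < c)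
    (y : E d) : ∫⁻ x, ENNReal.ofReal (gaussKer d c (x - y)) ∂μ
      ≤ ENNReal.ofReal (((2 * Real.pi) ^ d)⁻¹ * V) := by
  have hcont : Continuous fun x : E d => gaussKer d c (x - y) :=
    (continuous_gaussKer c).comp (by fun_prop)
  have hb : ∀ x : E d, gaussKer d c (x - y) ≤ (Real.pi * c) ^ ((d : ℝ) / 2) := fun x => by
    unfold gaussKer
    refine mul_le_of_le_one_right (by positivity) (Real.exp_le_one_iff.2 ?_)
    have : 0 ≤ Real.pi ^ 2 * c * ‖x - y‖ ^ 2 := by positivity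
    linarith
  have hi : Integrable (fun x : E d => gaussKer d c (x - y)) μ :=
    (integrable_const ((Real.pi * c) ^ ((d : ℝ) / 2))).mono' hcont.aestronglyMeasurable
      (.of_forall fun x => by
        rw [Real.norm_of_nonneg (gaussKer_nonneg hc _)]; exact hb x)
  rw [← ofReal_integral_eq_lintegral_ofReal hi (.of_forall fun x => gaussKer_nonneg hc _)]
  refine ENNReal.ofReal_le_ofReal ?_
  rw [inv_mul_eq_div, le_div_iff₀' (by positivity)]
  have hkey := congrArg norm (integral_gaussian_mul_charFun hc μ y)
  rw [Complex.norm_real, Real.norm_of_nonneg (mul_nonneg (by positivity)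
    (integral_nonneg fun x => gaussKer_nonneg hc _))] at hkey
  rw [← hkey]
  refine (norm_integral_le_lintegral_norm _).trans (ENNReal.toReal_le_of_le_ofReal hV ?_)
  refine (lintegral_mono fun ξ => ENNReal.ofReal_le_ofReal ?_).trans h
  rw [norm_mul, norm_cexp_gaussian]
  refine mul_le_of_le_one_left (norm_nonneg _) (Real.exp_le_one_iff.2 ?_)
  have : 0 ≤ (4 * Real.pi ^ 2 * c)⁻¹ * ‖ξ‖ ^ 2 := by positivity
  linarith

/-- A probability measure with integrable characteristic function is dominated by a multiple of
Lebesgue measure. -/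
theorem le_smul_volume_of_lintegral_charFun_le (μ : Measure (E d)) [IsProbabilityMeasure μ] {V : ℝ}
    (hV : 0 ≤ V) (h : ∫⁻ ξ, ENNReal.ofReal ‖charFun μ ξ‖ ≤ ENNReal.ofReal V) :
    μ ≤ ENNReal.ofReal (((2 * Real.pi) ^ d)⁻¹ * V) • (volume : Measure (E d)) := by
  set M := ((2 * Real.pi) ^ d)⁻¹ * V
  have hopen : ∀ U : Set (E d), IsOpen U → μ U ≤ ENNReal.ofReal M * volume U := by
    intro U hU
    have hm : ∀ n : ℕ, Measurable fun p : E d × E d =>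
        ENNReal.ofReal (gaussKer d ((n : ℝ) + 1) (p.1 - p.2)) := fun n => by
      have := measurable_gaussKer (d := d) ((n : ℝ) + 1)
      fun_prop
    let T : ℕ → E d → ℝ≥0∞ := fun n x =>
      ∫⁻ y in U, ENNReal.ofReal (gaussKer d ((n : ℝ) + 1) (x - y))
    have hT : ∀ n, Measurable (T n) := fun n =>
      Measurable.lintegral_prod_right' (ν := volume.restrict U) (hm n)
    have h1 : μ U ≤ ∫⁻ x, liminf (fun n => T n x) atTop ∂μ := by
      rw [← lintegral_indicator_one hU.measurableSet]
      refine lintegral_mono fun x => ?_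
      by_cases hx : x ∈ U
      · rw [Set.indicator_of_mem hx]
        exact one_le_liminf_lintegral_gaussKer hU hx
      · rw [Set.indicator_of_notMem hx]; exact zero_le
    have h2 : ∀ n, ∫⁻ x, T n x ∂μ ≤ ENNReal.ofReal M * volume U := fun n => by
      have hswap := lintegral_lintegral_swap (μ := μ) (ν := volume.restrict U)
        (f := fun x y => ENNReal.ofReal (gaussKer d ((n : ℝ) + 1) (x - y))) (hm n).aemeasurable
      rw [hswap, ← setLIntegral_const]
      exact lintegral_mono fun y => lintegral_gaussKer_sub_le μ hV h (by positivity) y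
    exact (h1.trans (lintegral_liminf_le hT)).trans
      (liminf_le_of_frequently_le' (Frequently.of_forall h2))
  have : (ENNReal.ofReal M • (volume : Measure (E d))).OuterRegular :=
    Measure.OuterRegular.smul _ ENNReal.ofReal_ne_top
  refine Measure.le_iff'.2 fun B => ?_
  rw [Set.measure_eq_iInf_isOpen B (ENNReal.ofReal M • (volume : Measure (E d)))]
  refine le_iInf fun U => le_iInf fun hBU => le_iInf fun hU => ?_
  exact (measure_mono hBU).trans (hopen U hU)

theorem exists_density_le (μ : Measure (E d)) [IsFiniteMeasure μ] {M : ℝ≥0∞}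
    (h : μ ≤ M • (volume : Measure (E d))) :
    ∃ p : E d → ℝ≥0∞, Measurable p ∧ μ = volume.withDensity p ∧ ∀ x, p x ≤ M := by
  have hac : μ ≪ volume := Measure.absolutelyContinuous_of_le_smul h
  have hm := Measure.measurable_rnDeriv μ volume
  have hle : μ.rnDeriv volume ≤ᵐ[volume] fun _ => M := by
    refine ae_le_of_forall_setLIntegral_le_of_sigmaFinite hm fun s hs _ => ?_
    rw [setLIntegral_const]
    exact (Measure.setLIntegral_rnDeriv_le s).trans (h s)
  -- The Radon–Nikodym derivative is bounded almost everywhere only; truncation corrects it.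
  refine ⟨fun x => min (μ.rnDeriv volume x) M, hm.min measurable_const, ?_,
    fun x => min_le_right _ _⟩
  conv_lhs => rw [← Measure.withDensity_rnDeriv_eq μ volume hac]
  refine withDensity_congr_ae ?_
  filter_upwards [hle] with x hx
  exact (min_eq_left hx).symm

end LevySmallTime

namespace LevySmallTime
namespace LevyTriplet

variable {d : ℕ} (τ : LevyTriplet d)

/-! ### Translation of the four conditions -/

theorem inv_lt_ofReal_iff {T : ℝ≥0∞} (hT : 0 < T) {r : ℝ} :
    T⁻¹ < ENNReal.ofReal r ↔ T⁻¹.toReal < r :=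
  ENNReal.lt_ofReal_iff_toReal_lt (ENNReal.inv_ne_top.2 hT.ne')

theorem C3_iff_scalingBound {T : ℝ≥0∞} (hT : 0 < T) :
    τ.C3 T ↔ τ.ScalingBound T⁻¹.toReal := by
  have hR : (0 : ℝ) ≤ T⁻¹.toReal := ENNReal.toReal_nonneg
  have hd0 : (0 : ℝ) ≤ d := Nat.cast_nonneg d
  simp only [C3, ScalingBound, inv_lt_ofReal_iff hT]
  set R := T⁻¹.toReal
  set K : ℝ := 1 + 15 * d with hK
  have hK1 : 1 ≤ K := by rw [hK]; linarith
  constructor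
  · rintro ⟨c, α, hc, hc1, hα, hα2, h1, h2⟩
    refine ⟨c / (2 * K), α, by positivity, ?_, hα, hα2, fun x hx => ?_, fun l r hl hr => ?_⟩
    · rw [div_le_one (by positivity)]; linarith
    · have h3 := τ.conc_le_psiStar (hR.trans_lt hx)
      have h4 := h1 x hx
      have h5 := τ.psiStar_nonneg (norm_nonneg x)
      rw [div_mul_eq_mul_div, div_le_iff₀ (by positivity)]
      have h6 : c * τ.conc ‖x‖ ≤ K * (c * τ.psiStar ‖x‖) := by nlinarith
      have h7 : K * (c * τ.psiStar ‖x‖) ≤ K * (τ.psi x).re :=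
        mul_le_mul_of_nonneg_left h4 (by linarith)
      have h8 : 0 ≤ τ.rePsi x * K := mul_nonneg (τ.rePsi_nonneg x) (by linarith)
      simp only [rePsi] at h8 ⊢
      linarith
    · have hr0 := hR.trans_lt hr
      have h3 := τ.conc_le_psiStar hr0
      have h4 := h2 l r hl hr
      have h5 := τ.psiStar_le_conc (r := l * r) (by nlinarith)
      have hlα : 0 ≤ c * l ^ α := by positivity
      rw [div_mul_eq_mul_div, div_mul_eq_mul_div, div_le_iff₀ (by positivity)]
      have h6 := mul_le_mul_of_nonneg_left h3 hlα
      have h7 : K * (c * l ^ α * τ.psiStar r) ≤ K * (2 * τ.conc (l * r)) :=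
        mul_le_mul_of_nonneg_left (h4.trans h5) (by linarith)
      linarith
  · rintro ⟨c, α, hc, hc1, hα, hα2, h1, h2⟩
    refine ⟨c / (2 * K), α, by positivity, ?_, hα, hα2, fun x hx => ?_, fun l r hl hr => ?_⟩
    · rw [div_le_one (by positivity)]; linarith
    · have h3 := mul_le_mul_of_nonneg_left (τ.psiStar_le_conc (norm_nonneg x)) hc.le
      have h4 := h1 x hx
      have h8 := τ.rePsi_nonneg x
      rw [div_mul_eq_mul_div, div_le_iff₀ (by positivity)]
      simp only [rePsi] at h4 h8
      nlinarith
    · have hr0 := hR.trans_lt hr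
      have h3 := τ.conc_le_psiStar (r := l * r) (by nlinarith)
      have h4 := h2 l r hl hr
      have h5 := τ.psiStar_le_conc hr0.le
      have hlα : 0 ≤ c * l ^ α := by positivity
      rw [div_mul_eq_mul_div, div_mul_eq_mul_div, div_le_iff₀ (by positivity)]
      have h6 := mul_le_mul_of_nonneg_left h5 hlα
      linarith

theorem C4_iff_momentBound {T : ℝ≥0∞} (hT : 0 < T) :
    τ.C4 T ↔ τ.MomentBound T⁻¹.toReal := by
  have hR : (0 : ℝ) ≤ T⁻¹.toReal := ENNReal.toReal_nonneg
  simp only [C4, MomentBound, inv_lt_ofReal_iff hT]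
  constructor
  · rintro ⟨c, hc, h⟩
    refine ⟨(1 + 15 * d) * c, by positivity, fun x hx => ?_⟩
    rw [mul_assoc]
    exact (τ.conc_le_psiStar (hR.trans_lt hx)).trans
      (mul_le_mul_of_nonneg_left (h x hx) (by positivity))
  · rintro ⟨c, hc, h⟩
    refine ⟨max 1 (2 * c), le_max_left _ _, fun x hx => ?_⟩
    have h1 := τ.psiStar_le_conc (norm_nonneg x)
    have h2 := h x hx
    rw [truncMoment] at h2
    refine le_trans ?_ (mul_le_mul_of_nonneg_right (le_max_right 1 (2 * c))
      (τ.truncMoment_nonneg x))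
    linarith

/-- Reparametrization of time by `t = 1 / conc r`, for which `h⁻¹(1/t) = 1 / r`. -/
theorem forall_time_iff (hinf : Tendsto τ.h (𝓝[>] 0) atTop) {T : ℝ≥0∞} {Q : ℝ → ℝ → Prop} :
    (∀ t : ℝ≥0, 0 < t → (t : ℝ≥0∞) < T → Q t (τ.hInv (1 / (t : ℝ)) ^ d)⁻¹) ↔
      ∀ r, 0 < r → ENNReal.ofReal (1 / τ.conc r) < T → Q (1 / τ.conc r) (r ^ d) := by
  constructor
  · intro h r hr hrT
    have hH := τ.conc_pos hinf hr
    have hpos : 0 < 1 / τ.conc r := by positivity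
    have := h (Real.toNNReal (1 / τ.conc r)) (Real.toNNReal_pos.2 hpos) hrT
    rwa [Real.coe_toNNReal _ hpos.le, one_div_one_div, τ.hInv_conc hinf hr, inv_pow, inv_inv]
      at this
  · intro h t ht htT
    have ht' : (0 : ℝ) < t := ht
    obtain ⟨r, hr, hrt⟩ := τ.conc_surjective hinf (one_div_pos.2 ht')
    have hrt' : 1 / τ.conc r = t := by rw [hrt, one_div_one_div]
    have := h r hr (by rwa [hrt', ENNReal.ofReal_coe_nnreal])
    rwa [← hrt, τ.hInv_conc hinf hr, inv_pow, inv_inv, ← hrt']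

theorem C2_iff (hinf : Tendsto τ.h (𝓝[>] 0) atTop) {T : ℝ≥0∞} :
    τ.C2 T ↔ ∃ c : ℝ, 0 < c ∧ ∀ r, 0 < r → ENNReal.ofReal (1 / τ.conc r) < T →
      τ.expInt (1 / τ.conc r) ≤ ENNReal.ofReal (c * r ^ d) :=
  exists_congr fun c => and_congr_right fun _ =>
    τ.forall_time_iff hinf (Q := fun t v => τ.expInt t ≤ ENNReal.ofReal (c * v))

/-- A bound up to a time horizon is a bound beyond a frequency threshold; infinite horizons
correspond to the threshold `0`. -/
theorem C2.exists_integralBound (hinf : Tendsto τ.h (𝓝[>] 0) atTop) {T : ℝ≥0∞} (hT : 0 < T)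
    (h : τ.C2 T) : ∃ T' : ℝ≥0∞, 0 < T' ∧ (T = ∞ → T' = ∞) ∧ τ.IntegralBound T'⁻¹.toReal := by
  obtain ⟨c, hc, h⟩ := (τ.C2_iff hinf).1 h
  by_cases hTtop : T = ∞
  · subst hTtop
    refine ⟨∞, ENNReal.zero_lt_top, fun _ => rfl, c, hc, fun r hr => ?_⟩
    exact h r (by simpa using hr) ENNReal.ofReal_lt_top
  · have hT0 : 0 < T.toReal := ENNReal.toReal_pos hT.ne' hTtop
    obtain ⟨R, hR, hRT⟩ := τ.conc_surjective hinf (one_div_pos.2 hT0)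
    refine ⟨ENNReal.ofReal R⁻¹, by simpa using hR, fun h' => absurd h' hTtop, c, hc,
      fun r hr => ?_⟩
    rw [← ENNReal.ofReal_inv_of_pos (inv_pos.2 hR), inv_inv, ENNReal.toReal_ofReal hR.le] at hr
    refine h r (hR.trans hr) ?_
    rw [ENNReal.ofReal_lt_iff_lt_toReal (by
      have := τ.conc_pos hinf (hR.trans hr); positivity) hTtop,
      one_div_lt (τ.conc_pos hinf (hR.trans hr)) hT0, ← hRT]
    exact τ.conc_strictMono hinf hR hr

theorem IntegralBound.exists_C2 (hinf : Tendsto τ.h (𝓝[>] 0) atTop) {T : ℝ≥0∞} (hT : 0 < T)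
    (h : τ.IntegralBound T⁻¹.toReal) : ∃ T' : ℝ≥0∞, 0 < T' ∧ (T = ∞ → T' = ∞) ∧ τ.C2 T' := by
  simp only [τ.C2_iff hinf]
  obtain ⟨c, hc, h⟩ := h
  by_cases hTtop : T = ∞
  · subst hTtop
    exact ⟨∞, ENNReal.zero_lt_top, fun _ => rfl, c, hc, fun r hr _ => h r (by simpa using hr)⟩
  · have hR : 0 < T⁻¹.toReal :=
      ENNReal.toReal_pos (ENNReal.inv_ne_zero.2 hTtop) (ENNReal.inv_ne_top.2 hT.ne')
    have hH := τ.conc_pos hinf hR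
    refine ⟨ENNReal.ofReal (1 / τ.conc T⁻¹.toReal), by simpa using hH,
      fun h' => absurd h' hTtop, c, hc, fun r hr hrT => h r (τ.lt_of_conc_lt hr.le ?_)⟩
    rw [ENNReal.ofReal_lt_ofReal_iff (by positivity)] at hrT
    exact lt_of_one_div_lt_one_div (τ.conc_pos hinf hr) hrT

/-! ### Densities -/

section Densities

variable {Ω : Type*} [MeasurableSpace Ω] {Y : ℝ≥0 → Ω → E d} {P : Measure Ω}

theorem Generates.norm_charFun {τ : LevyTriplet d} (hτ : τ.Generates Y P) (t : ℝ≥0) (x : E d) :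
    ‖charFun (P.map (Y t)) x‖ = Real.exp (-(t : ℝ) * τ.rePsi x) := by
  rw [hτ t x, Complex.norm_exp, ← Complex.ofReal_neg, Complex.re_ofReal_mul, rePsi]

/-- For `t < T` the characteristic function is integrable with the required bound; for `t ≥ T` it is
still integrable, since `exp(-t Re ψ)` decreases in `t`, so that a density exists. -/
theorem C2.C1 {τ : LevyTriplet d} [IsProbabilityMeasure P] (hY : ∀ t, Measurable (Y t))
    (hτ : τ.Generates Y P) {T : ℝ≥0∞} (hT : 0 < T) (h : τ.C2 T) : τ.C1 Y P T := by
  obtain ⟨c, hc, h⟩ := h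
  have hprob : ∀ t, IsProbabilityMeasure (P.map (Y t)) := fun t =>
    Measure.isProbabilityMeasure_map (hY t).aemeasurable
  have hdom : ∀ (t : ℝ≥0) (V : ℝ), 0 ≤ V → τ.expInt t ≤ ENNReal.ofReal V →
      P.map (Y t) ≤ ENNReal.ofReal (((2 * Real.pi) ^ d)⁻¹ * V) • volume := fun t V hV hle =>
    le_smul_volume_of_lintegral_charFun_le _ hV (by simp only [hτ.norm_charFun]; exact hle)
  have hfin : ∀ t : ℝ≥0, 0 < t → τ.expInt t ≠ ∞ := fun t ht => by
    obtain ⟨s, hs0, hs⟩ := ENNReal.lt_iff_exists_nnreal_btwn.1 (lt_min hT (ENNReal.coe_pos.2 ht))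
    have hs0' : 0 < s := ENNReal.coe_pos.1 hs0
    have hst : s ≤ t := ENNReal.coe_le_coe.1 (hs.le.trans (min_le_right _ _))
    exact ((τ.expInt_anti (NNReal.coe_le_coe.2 hst)).trans_lt
      ((h s hs0' (hs.trans_le (min_le_left _ _))).trans_lt ENNReal.ofReal_lt_top)).ne
  have hbound : ∀ t : ℝ≥0, ∃ p : E d → ℝ≥0∞, 0 < t → Measurable p ∧
      P.map (Y t) = volume.withDensity p ∧
        ((t : ℝ≥0∞) < T → ∀ x, p x ≤ ENNReal.ofReal (((2 * Real.pi) ^ d)⁻¹ *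
          (max 0 (c * (τ.hInv (1 / (t : ℝ)) ^ d)⁻¹)))) := fun t => by
    by_cases ht : 0 < t
    · by_cases htT : (t : ℝ≥0∞) < T
      · obtain ⟨p, hp, hp', hp''⟩ := exists_density_le _ (hdom t _ (le_max_left 0 _)
          ((h t ht htT).trans (ENNReal.ofReal_le_ofReal (le_max_right 0 _))))
        exact ⟨p, fun _ => ⟨hp, hp', fun _ => hp''⟩⟩
      · obtain ⟨p, hp, hp', -⟩ := exists_density_le _ (hdom t (τ.expInt t).toReal
          ENNReal.toReal_nonneg (ENNReal.ofReal_toReal (hfin t ht)).ge)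
        exact ⟨p, fun _ => ⟨hp, hp', fun h' => absurd h' htT⟩⟩
    · exact ⟨0, fun h' => absurd h' ht⟩
  choose p hp using hbound
  refine ⟨p, fun t ht => ⟨(hp t ht).1, (hp t ht).2.1⟩, ((2 * Real.pi) ^ d)⁻¹ * c, by positivity,
    fun t ht htT => iSup_le fun x => ((hp t ht).2.2 htT x).trans ?_⟩
  rw [mul_assoc, ENNReal.ofReal_mul (by positivity), ENNReal.ofReal_mul (p := _ ⁻¹) (by positivity)]
  simp [ENNReal.ofReal_max]

/-- Boundedness of the density at time `t` bounds the integral at time `2t` only; the doubling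
property of `conc`, itself a consequence of that bound, brings the time back to `t`. -/
theorem C1.C2 {τ : LevyTriplet d} [IsProbabilityMeasure P] (hd : 1 ≤ d)
    (hinf : Tendsto τ.h (𝓝[>] 0) atTop) (hY : ∀ t, Measurable (Y t))
    (hτ : τ.Generates Y P) {T : ℝ≥0∞} (h : τ.C1 Y P T) : τ.C2 T := by
  obtain ⟨p, hp, c, hc, hb⟩ := h
  have hb' : ∀ t : ℝ≥0, 0 < t → (t : ℝ≥0∞) < T → ∀ M : ℝ, 0 ≤ M →
      (⨆ x, p t x) ≤ ENNReal.ofReal M →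
        τ.expInt (2 * t) ≤ ENNReal.ofReal ((2 * Real.pi) ^ d * M) := fun t ht htT M hM hle => by
    have := Measure.isProbabilityMeasure_map (μ := P) (hY t).aemeasurable
    have hle' : P.map (Y t) ≤ ENNReal.ofReal M • (volume : Measure (E d)) := by
      rw [(hp t ht).2, ← withDensity_const]
      exact withDensity_mono (.of_forall fun x => (le_iSup (p t) x).trans hle)
    refine le_trans (le_of_eq ?_) (lintegral_norm_sq_charFun_le _ hM hle')
    refine lintegral_congr fun z => ?_
    rw [hτ.norm_charFun, ← Real.exp_nat_mul]
    congr 2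
    push_cast
    ring
  have hdouble : ∀ r, 0 < r → ENNReal.ofReal (1 / τ.conc r) < T →
      τ.expInt (2 / τ.conc r) ≤ ENNReal.ofReal ((2 * Real.pi) ^ d * c * r ^ d) := by
    intro r hr hrT
    have hH := τ.conc_pos hinf hr
    have hpos : 0 < 1 / τ.conc r := by positivity
    have h1 := hb' (Real.toNNReal (1 / τ.conc r)) (Real.toNNReal_pos.2 hpos) hrT (c * r ^ d)
      (by positivity) ((hb _ (Real.toNNReal_pos.2 hpos) hrT).trans (le_of_eq (by
        rw [Real.coe_toNNReal _ hpos.le, one_div_one_div, τ.hInv_conc hinf hr, inv_pow, inv_inv])))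
    rwa [Real.coe_toNNReal _ hpos.le, mul_one_div, ← mul_assoc] at h1
  obtain ⟨B, hB, hdoub⟩ := τ.exists_doubling hd hinf (c := (2 * Real.pi) ^ d * c) (by positivity)
  refine (τ.C2_iff hinf).2 ⟨(2 * Real.pi) ^ d * c * B ^ d, by positivity, fun r hr hrT => ?_⟩
  have hH := τ.conc_pos hinf hr
  obtain ⟨r', hr', hrr'⟩ := τ.conc_surjective hinf (u := 2 * τ.conc r) (by positivity)
  have h1 := hdouble r' hr' (lt_of_le_of_lt (ENNReal.ofReal_le_ofReal (by
    rw [hrr']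
    exact one_div_le_one_div_of_le hH (by linarith))) hrT)
  have h2 : 2 / τ.conc r' = 1 / τ.conc r := by rw [hrr']; field_simp
  have h3 : r' ≤ B * r := by
    by_contra! hlt
    have h4 := τ.conc_strictMono hinf (by positivity) hlt
    have h5 := hdoub r hr (hdouble r hr hrT)
    linarith
  rw [h2] at h1
  refine h1.trans (ENNReal.ofReal_le_ofReal ?_)
  calc (2 * Real.pi) ^ d * c * r' ^ d ≤ (2 * Real.pi) ^ d * c * (B * r) ^ d := by gcongr
    _ = _ := by rw [mul_pow]; ring

end Densities

end LevyTriplet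
end LevySmallTime

theorem mainTheorem1 {d : ℕ} (hd : 1 ≤ d) {Ω : Type*} [MeasurableSpace Ω]
    (P : Measure Ω) [IsProbabilityMeasure P]
    (Y : ℝ≥0 → Ω → LevySmallTime.E d) (hY : LevySmallTime.IsLevyProcess Y P)
    (τ : LevySmallTime.LevyTriplet d) (hτ : τ.Generates Y P)
    (hinf : Tendsto τ.h (𝓝[>] 0) atTop) :
    List.TFAE [∃ T : ℝ≥0∞, 0 < T ∧ τ.C1 Y P T, ∃ T : ℝ≥0∞, 0 < T ∧ τ.C2 T,
      ∃ T : ℝ≥0∞, 0 < T ∧ τ.C3 T, ∃ T : ℝ≥0∞, 0 < T ∧ τ.C4 T] ∧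
    List.TFAE [τ.C1 Y P ∞, τ.C2 ∞, τ.C3 ∞, τ.C4 ∞] := by
  have h12 : ∀ T : ℝ≥0∞, 0 < T → (τ.C1 Y P T ↔ τ.C2 T) := fun T hT =>
    ⟨LevySmallTime.LevyTriplet.C1.C2 hd hinf hY.measurable hτ,
      LevySmallTime.LevyTriplet.C2.C1 hY.measurable hτ hT⟩
  have h34 : ∀ T : ℝ≥0∞, 0 < T → (τ.C3 T ↔ τ.C4 T) := fun T hT => by
    rw [τ.C3_iff_scalingBound hT, τ.C4_iff_momentBound hT]
    exact ⟨LevySmallTime.LevyTriplet.ScalingBound.momentBound τ ENNReal.toReal_nonneg,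
      LevySmallTime.LevyTriplet.MomentBound.scalingBound τ hd ENNReal.toReal_nonneg⟩
  have h23 : ∀ T : ℝ≥0∞, 0 < T → τ.C2 T → ∃ T' : ℝ≥0∞, 0 < T' ∧ (T = ∞ → T' = ∞) ∧ τ.C3 T' :=
    fun T hT h => by
      obtain ⟨T', hT', himp, hb⟩ := LevySmallTime.LevyTriplet.C2.exists_integralBound τ hinf hT h
      exact ⟨T', hT', himp, (τ.C3_iff_scalingBound hT').2
        (LevySmallTime.LevyTriplet.IntegralBound.scalingBound τ hd hinf ENNReal.toReal_nonneg hb)⟩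
  have h32 : ∀ T : ℝ≥0∞, 0 < T → τ.C3 T → ∃ T' : ℝ≥0∞, 0 < T' ∧ (T = ∞ → T' = ∞) ∧ τ.C2 T' :=
    fun T hT h => LevySmallTime.LevyTriplet.IntegralBound.exists_C2 τ hinf hT
      (LevySmallTime.LevyTriplet.ScalingBound.integralBound τ hd hinf
        ENNReal.toReal_nonneg ((τ.C3_iff_scalingBound hT).1 h))
  constructor
  · tfae_have 1 ↔ 2 := exists_congr fun T => and_congr_right fun hT => h12 T hT
    tfae_have 3 ↔ 4 := exists_congr fun T => and_congr_right fun hT => h34 T hT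
    tfae_have 2 → 3 := fun ⟨T, hT, h⟩ => by
      obtain ⟨T', hT', -, h'⟩ := h23 T hT h
      exact ⟨T', hT', h'⟩
    tfae_have 3 → 2 := fun ⟨T, hT, h⟩ => by
      obtain ⟨T', hT', -, h'⟩ := h32 T hT h
      exact ⟨T', hT', h'⟩
    tfae_finish
  · have htop : (0 : ℝ≥0∞) < ∞ := ENNReal.zero_lt_top
    tfae_have 1 ↔ 2 := h12 ∞ htop
    tfae_have 3 ↔ 4 := h34 ∞ htop
    tfae_have 2 → 3 := fun h => by
      obtain ⟨T', -, himp, h'⟩ := h23 ∞ htop h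
      rwa [himp rfl] at h'
    tfae_have 3 → 2 := fun h => by
      obtain ⟨T', -, himp, h'⟩ := h32 ∞ htop h
      rwa [himp rfl] at h'
    tfae_finish
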